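/- Let $q\in\mathbb C$ be such that $q^2$ has finite multiplicative order $\ell\ge 3$. For integers $0\le t\le n$ with $n-t$ even let $W_t(n)$ be the cell module of the Temperley--Lieb algebra $\mathrm{TL}_n(q)$ (over $\mathbb C$, with loop parameter $-(q+q^{-1})$). It has as basis the monic Temperley--Lieb diagrams from $t$ to $n$ (planar perfect matchings of $t$ lower and $n$ upper points in which every lower point is joined to an upper point). It carries the bilinear form $(\,,\,)$ given on monic diagrams by $D_1^*D_2=(D_1,D_2)\,\mathrm{id}_t$ if $D_1^*D_2$ is a multiple of $\mathrm{id}_t$, and $(D_1,D_2)=0$ otherwise; here $D^*$ is the reflection of $D$ in a horizontal line, and each closed loop in a product of diagrams contributes a factor $-(q+q^{-1})$. Let $L_t(n)=W_t(n)/\mathrm{Rad}_t$ be the quotient by the radical of this form, and put $$L_t^{(\ell)}(x)=\sum_{k=0}^\infty \dim_{\mathbb C}\bigl(L_t(t+2k)\bigr)\,x^k .$$ Define $p_i(x)\in\mathbb Z[x]$ for $i\ge1$ by $p_1=p_2=1$ and $p_{i+1}=p_i-x\,p_{i-1}$ for $i\ge 2$, and let $c(x)=\sum_{n\ge0}\frac1{n+1}\binom{2n}{n}x^n$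 be the Catalan series. Then for all integers $a\ge 0$ and $0\le b\le \ell-2$, with $t=a\ell+b$, one has the identity of formal power series $$L_t^{(\ell)}(x)=\frac{p_{\ell-1-b}(x)}{p_\ell(x)}\,c(x)^{a\ell}.$$ -/

import Mathlib

open scoped PowerSeries Polynomial

namespace TemperleyLieb

/-- Position of a boundary point of a rectangle with `m` points on its lower edge (`Sum.inl`) and
`n` points on its upper edge (`Sum.inr`), both numbered from left to right. The order of positions
is the order in which the points are met on a walk along the boundary that starts at the lower
right corner, follows the lower edge to the left and then the upper edge to the right. -/
def pos {m n : ℕ} : Fin m ⊕ Fin n → ℤ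
  | Sum.inl i => -((i : ℕ) : ℤ) - 1
  | Sum.inr j => ((j : ℕ) : ℤ)

/-- A Temperley-Lieb diagram from `m` to `n` (without closed loops): a perfect matching of the `m`
lower and `n` upper boundary points, whose arcs can be drawn in the rectangle without crossings. -/
@[ext]
structure Diagram (m n : ℕ) where
  /-- the other end of the arc at a given boundary point -/
  mate : Fin m ⊕ Fin n → Fin m ⊕ Fin n
  mate_mate : ∀ x, mate (mate x) = x
  mate_ne : ∀ x, mate x ≠ x
  planar : ∀ x y, ¬ (pos x < pos y ∧ pos y < pos (mate x) ∧ pos (mate x) < pos (mate y))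

instance (m n : ℕ) : Finite (Diagram m n) :=
  Finite.of_injective Diagram.mate fun _ _ h => Diagram.ext h

theorem pos_swap {m n : ℕ} (x : Fin m ⊕ Fin n) : pos x.swap = -pos x - 1 := by
  rcases x with i | j <;> simp [pos]

/-- The reflection `D^*` of a diagram in a horizontal line. -/
def Diagram.star {m n : ℕ} (D : Diagram m n) : Diagram n m where
  mate x := (D.mate x.swap).swap
  mate_mate x := by simp [D.mate_mate]
  mate_ne x h := D.mate_ne x.swap (by
    have h' := congrArg Sum.swap h
    simpa using h')
  planar x y := by
    rintro ⟨h1, h2, h3⟩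
    have e1 := pos_swap x
    have e2 := pos_swap y
    rw [pos_swap] at h2 h3
    rw [pos_swap] at h3
    refine D.planar (D.mate y.swap) (D.mate x.swap) ?_
    rw [D.mate_mate, D.mate_mate]
    exact ⟨by omega, by omega, by omega⟩

/-- A diagram is monic if no arc joins two lower points. -/
def Diagram.Monic {m n : ℕ} (D : Diagram m n) : Prop :=
  ∀ i : Fin m, ∃ j : Fin n, D.mate (Sum.inl i) = Sum.inr j

/-- The points of the picture with a diagram `n → r` stacked on top of a diagram `m → n`. -/
inductive StackPoint (m n r : ℕ) : Type
  | lower (i : Fin m)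
  | middle (j : Fin n)
  | upper (k : Fin r)

/-- The boundary points of the lower of two stacked diagrams. -/
def inLower {m n : ℕ} (r : ℕ) : Fin m ⊕ Fin n → StackPoint m n r :=
  Sum.elim StackPoint.lower StackPoint.middle

/-- The boundary points of the upper of two stacked diagrams. -/
def inUpper (m : ℕ) {n r : ℕ} : Fin n ⊕ Fin r → StackPoint m n r :=
  Sum.elim StackPoint.middle StackPoint.upper

/-- The picture obtained by stacking `E` on top of `D`, as a graph: the edges are the arcs of `D`
and the arcs of `E`. -/
def stack {m n r : ℕ} (E : Diagram n r) (D : Diagram m n) : SimpleGraph (StackPoint m n r) :=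
  SimpleGraph.fromRel fun u v =>
    (∃ x, u = inLower r x ∧ v = inLower r (D.mate x)) ∨
      (∃ y, u = inUpper m y ∧ v = inUpper m (E.mate y))

/-- The number of closed loops in the product `E D`: the components of the stacked picture all of
whose points lie on the middle line. -/
noncomputable def loops {m n r : ℕ} (E : Diagram n r) (D : Diagram m n) : ℕ :=
  {C : (stack E D).ConnectedComponent |
    ∀ u ∈ C.supp, ∃ j, u = StackPoint.middle j}.ncard

/-- For `D : t → n` and `E : n → t`: apart from closed loops, the product `E D` is the identity
diagram of `t`, i.e. for every `i` the `i`-th lower point is joined to the `i`-th upper point. -/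
def IsMultipleOfId {t n : ℕ} (E : Diagram n t) (D : Diagram t n) : Prop :=
  ∀ i : Fin t, (stack E D).Reachable (StackPoint.lower i) (StackPoint.upper i)

/-- The cell module `W_t(n)` (as a complex vector space): it has the monic diagrams `t → n` as a
basis. -/
abbrev CellModule (t n : ℕ) : Type := {D : Diagram t n // D.Monic} →₀ ℂ

open Classical in
/-- The value of the invariant form on two monic diagrams `D₁, D₂ : t → n`: the coefficient of
`id_t` in `D₁^* D₂` if this is a multiple of `id_t`, and `0` otherwise. Every closed loop
contributes a factor `-(q + q⁻¹)`. -/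
noncomputable def diagramForm (q : ℂ) {t n : ℕ} (D₁ D₂ : Diagram t n) : ℂ :=
  if IsMultipleOfId D₁.star D₂ then (-(q + q⁻¹)) ^ loops D₁.star D₂ else 0

/-- The invariant form on the cell module `W_t(n)`, extended bilinearly from the diagrams. -/
noncomputable def cellForm (q : ℂ) (t n : ℕ) : LinearMap.BilinForm ℂ (CellModule t n) :=
  Finsupp.linearCombination ℂ fun D₁ : {D : Diagram t n // D.Monic} =>
    Finsupp.linearCombination ℂ fun D₂ : {D : Diagram t n // D.Monic} =>
      diagramForm q D₁.1 D₂.1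

theorem cellForm_single_single (q : ℂ) (t n : ℕ) (D₁ D₂ : {D : Diagram t n // D.Monic}) :
    cellForm q t n (Finsupp.single D₁ 1) (Finsupp.single D₂ 1) = diagramForm q D₁.1 D₂.1 := by
  simp [cellForm]

/-- The radical of the invariant form: all `v` with `(v, w) = 0` for every `w`. -/
noncomputable def cellRad (q : ℂ) (t n : ℕ) : Submodule ℂ (CellModule t n) :=
  LinearMap.ker (cellForm q t n)

/-- The underlying complex vector space of `L_t(n) = W_t(n) / Rad_t`, the head of the cell module
`W_t(n)` of the Temperley-Lieb algebra with parameter `q`. -/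
abbrev CellHead (q : ℂ) (t n : ℕ) : Type := CellModule t n ⧸ cellRad q t n

/-- The generating function `∑ k, dim L_t(t + 2k) x ^ k`. -/
noncomputable def simpleSeries (q : ℂ) (t : ℕ) : ℚ⟦X⟧ :=
  PowerSeries.mk fun k => (Module.finrank ℂ (CellHead q t (t + 2 * k)) : ℚ)

/-- The polynomials `p₁ = p₂ = 1`, `p_{i+1} = p_i - x p_{i-1}` for `i ≥ 2`. The value at the index
`0` is a convention that is not used. -/
noncomputable def chebPoly : ℕ → ℤ[X]
  | 0 => 0
  | 1 => 1
  | 2 => 1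
  | (i + 3) => chebPoly (i + 2) - Polynomial.X * chebPoly (i + 1)

/-- The polynomial `p_i` as a power series over the rationals. -/
noncomputable def chebSeries (i : ℕ) : ℚ⟦X⟧ :=
  (((chebPoly i).map (Int.castRingHom ℚ) : ℚ[X]) : ℚ⟦X⟧)

/-- The constant term of `p_i` is `1` for `i ≥ 1`, so that `p_i` is an invertible power series. -/
theorem constantCoeff_chebSeries (i : ℕ) : PowerSeries.constantCoeff (chebSeries (i + 1)) = 1 := by
  have h : ∀ i, (chebPoly (i + 1)).coeff 0 = 1 := by
    intro i
    induction i using Nat.strong_induction_on with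
    | _ i ih =>
      match i with
      | 0 => simp [chebPoly]
      | 1 => simp [chebPoly]
      | (j + 2) => simp [chebPoly, ih (j + 1) (by omega)]
  simp [chebSeries, ← PowerSeries.coeff_zero_eq_constantCoeff_apply, Polynomial.coeff_coe, h i]

/-- The Catalan series `c(x) = ∑ n, (1 / (n + 1)) * binom (2n) n * x ^ n`. -/
noncomputable def catalanC : ℚ⟦X⟧ :=
  PowerSeries.map (Nat.castRingHom ℚ) PowerSeries.catalanSeries

end TemperleyLieb

/-! Write $[m]$ for the quantum integer as a polynomial in the loop parameter $\delta$, and $G_t(n)$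
for the Gram matrix of the form on $W_t(n)$ over $\mathbb C[\delta]$. A monic diagram from $t+1$ to
$n+1$ either has a through strand at its right end (`up` of a diagram $t\to n$) or comes from a
diagram $t+2\to n$ by bending the last lower point upwards (`down`). Iterating this identifies monic
diagrams with lattice paths.

The key is a correction of Jones--Wenzl type: for $p : t+2\to n$, the vector
$[t+2]\,p.\mathrm{down}+\sum_{j\le t}[t+1-j]\,(p.\mathrm{cupAt}\,j).\mathrm{up}$ is orthogonal to
every `up` and pairs with $p'.\mathrm{down}$ to $-[t+3](p',p)$. This is `gram_mul_cupMatrix` and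
`mixedGram_transpose_mul_cupMatrix`. Hence a base change of determinant a power of $[t+2]$ turns
$G_{t+1}(n+1)$ into $G_t(n)\oplus -[t+2][t+3]\,G_{t+2}(n)$.

These identities are polynomial in $\delta$, so it suffices to check them at all large integers
$\delta=N$. There the form counts colourings with $N$ colours that are constant on arcs, the lower
points having fixed distinct colours (`eval_formPoly_card`); distinctness leaves only pairs whose
product is a multiple of the identity.

At the given $q$ one has $[m]=0$ iff $\ell\mid m$. For $\ell\nmid t+2$ the block form gives a rank
recursion whose second term drops out when $\ell\mid t+3$. The recursion needs an initial value on
the walls $\ell\mid t+1$, where it does not apply. There the form is non-degenerate: the determinant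
recursion yields the order of vanishing of $\det G_t(n)$ as a sum of differences of the orders of
$[t+j+2]$ and $[j+1]$, and these orders are $\ell$-periodic in positive indices
(`rank_gramAt_of_dvd`). So on a wall dimensions are ballot numbers, with series $c^{t+1}$. Between
two walls the rank recursion is the recursion of the $p_i$, with $i$ the distance to the upper wall.
-/

namespace TemperleyLieb

/-! ### Lattice paths and tuples of colours -/

/-- Lattice paths with `n` steps from height `0` to height `t` that stay non-negative. -/
inductive Path : ℕ → ℕ → Type
  | nil : Path 0 0
  | up {t n : ℕ} (p : Path t n) : Path (t + 1) (n + 1)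
  | down {t n : ℕ} (p : Path (t + 1) n) : Path t (n + 1)

/-- Tuples of length `n`, built as iterated pairs. -/
def Tuple (C : Type) : ℕ → Type
  | 0 => Unit
  | n + 1 => C × Tuple C n

instance Tuple.instFintype (C : Type) [Fintype C] : ∀ n, Fintype (Tuple C n)
  | 0 => inferInstanceAs (Fintype Unit)
  | n + 1 => @instFintypeProd C (Tuple C n) _ (Tuple.instFintype C n)

instance Tuple.instDecidableEq (C : Type) [DecidableEq C] : ∀ n, DecidableEq (Tuple C n)
  | 0 => inferInstanceAs (DecidableEq Unit)
  | n + 1 => @instDecidableEqProd C (Tuple C n) _ (Tuple.instDecidableEq C n)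

section Tuples

variable {C : Type}

/-- The empty tuple. -/
def Tuple.nil : Tuple C 0 := ()

/-- Adding an entry in front of a tuple. -/
def Tuple.cons {n : ℕ} (x : C) (c : Tuple C n) : Tuple C (n + 1) := (x, c)

@[elab_as_elim]
theorem Tuple.cases_cons {n : ℕ} {P : Tuple C (n + 1) → Prop}
    (h : ∀ x c, P (Tuple.cons x c)) (c : Tuple C (n + 1)) : P c := h c.1 c.2

theorem Tuple.eq_nil (c : Tuple C 0) : c = Tuple.nil := rfl

@[simp] theorem Tuple.cons_inj {n : ℕ} {x y : C} {c d : Tuple C n} :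
    Tuple.cons x c = Tuple.cons y d ↔ x = y ∧ c = d := Prod.mk_inj

theorem Tuple.sum_zero [Fintype C] (f : Tuple C 0 → ℂ) : ∑ c, f c = f Tuple.nil :=
  Fintype.sum_unique (ι := Unit) f

theorem Tuple.sum_succ [Fintype C] {n : ℕ} (f : Tuple C (n + 1) → ℂ) :
    ∑ c, f c = ∑ x, ∑ c, f (Tuple.cons x c) :=
  Fintype.sum_prod_type (f := f)

/-- Membership of a value in a tuple. -/
def Tuple.Mem (x : C) : ∀ {n : ℕ}, Tuple C n → Prop
  | 0, _ => False
  | _ + 1, c => x = c.1 ∨ Tuple.Mem x c.2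

/-- The entries of a tuple are pairwise distinct. -/
def Tuple.Nodup : ∀ {n : ℕ}, Tuple C n → Prop
  | 0, _ => True
  | _ + 1, c => ¬ Tuple.Mem c.1 c.2 ∧ Tuple.Nodup c.2

@[simp] theorem Tuple.mem_cons {n : ℕ} {x y : C} {c : Tuple C n} :
    Tuple.Mem x (Tuple.cons y c) ↔ x = y ∨ Tuple.Mem x c := Iff.rfl

@[simp] theorem Tuple.nodup_cons {n : ℕ} {x : C} {c : Tuple C n} :
    Tuple.Nodup (Tuple.cons x c) ↔ ¬ Tuple.Mem x c ∧ Tuple.Nodup c := Iff.rfl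

/-- Insertion of two copies of `d` below the first `i` entries. -/
def Tuple.ins : ∀ {t : ℕ}, ℕ → Tuple C t → C → Tuple C (t + 2)
  | _, 0, c, d => Tuple.cons d (Tuple.cons d c)
  | 0, _ + 1, c, d => Tuple.cons d (Tuple.cons d c)
  | _ + 1, i + 1, c, d => Tuple.cons c.1 (Tuple.ins i c.2 d)

@[simp] theorem Tuple.ins_zero {t : ℕ} (c : Tuple C t) (d : C) :
    Tuple.ins 0 c d = Tuple.cons d (Tuple.cons d c) := by
  cases t <;> rfl

@[simp] theorem Tuple.ins_succ {t : ℕ} (i : ℕ) (x : C) (c : Tuple C t) (d : C) :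
    Tuple.ins (i + 1) (Tuple.cons x c) d = Tuple.cons x (Tuple.ins i c d) := rfl

@[simp] theorem Tuple.ins_nil (i : ℕ) (d : C) :
    Tuple.ins i (Tuple.nil : Tuple C 0) d = Tuple.cons d (Tuple.cons d Tuple.nil) := by
  cases i <;> rfl

/-! ### Quantum integers and combinations of cups -/

/-- Quantum integers with parameter `-δ = q + q⁻¹`. -/
def qnum {R : Type*} [CommRing R] (δ : R) : ℕ → R
  | 0 => 0
  | 1 => 1
  | n + 2 => -δ * qnum δ (n + 1) - qnum δ n

@[simp] theorem qnum_zero {R : Type*} [CommRing R] (δ : R) : qnum δ 0 = 0 := rfl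

@[simp] theorem qnum_one {R : Type*} [CommRing R] (δ : R) : qnum δ 1 = 1 := rfl

theorem qnum_add_two {R : Type*} [CommRing R] (δ : R) (n : ℕ) :
    qnum δ (n + 2) = -δ * qnum δ (n + 1) - qnum δ n := rfl

/-- The combination of cups with quantum integer coefficients, contracted with a matrix entry. -/
def cupSum [Fintype C] {t : ℕ} (f : Tuple C (t + 2) → ℂ) (c : Tuple C t) : ℂ :=
  ∑ j ∈ Finset.range (t + 1), qnum (Fintype.card C : ℂ) (t + 1 - j) * ∑ d, f (Tuple.ins j c d)

theorem cupSum_const_mul [Fintype C] {t : ℕ} (k : ℂ) (f : Tuple C (t + 2) → ℂ) (c : Tuple C t) :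
    cupSum (fun e => k * f e) c = k * cupSum f c := by
  simp only [cupSum, Finset.mul_sum]
  refine Finset.sum_congr rfl fun j _ => Finset.sum_congr rfl fun d _ => by ring

/-- The first and the remaining terms of a combination of cups. -/
theorem cupSum_cons [Fintype C] {t : ℕ} (f : Tuple C (t + 3) → ℂ) (y : C) (c : Tuple C t) :
    cupSum f (Tuple.cons y c) = cupSum (fun e => f (Tuple.cons y e)) c +
      qnum (Fintype.card C : ℂ) (t + 2) *
        ∑ d, f (Tuple.cons d (Tuple.cons d (Tuple.cons y c))) := by
  simp [cupSum, Finset.sum_range_succ' _ (t + 1)]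

/-! ### State sums of paths -/

variable [DecidableEq C]

/-- The weight of a path: `1` if the colouring `s` of the upper points and the colouring `c` of
the lower points are constant on the arcs of the diagram of the path, and `0` otherwise. Tuples
start with the last point. -/
def Path.weight : ∀ {t n : ℕ}, Path t n → Tuple C t → Tuple C n → ℂ
  | _, _, .nil, _, _ => 1
  | _, _, .up p, c, s => if c.1 = s.1 then p.weight c.2 s.2 else 0
  | _, _, .down p, c, s => p.weight (Tuple.cons s.1 c) s.2

@[simp] theorem Path.weight_nil (c : Tuple C 0) (s : Tuple C 0) :
    Path.nil.weight c s = 1 := rfl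

@[simp] theorem Path.weight_up {t n : ℕ} (p : Path t n) (x y : C) (c : Tuple C t) (s : Tuple C n) :
    p.up.weight (Tuple.cons x c) (Tuple.cons y s) = if x = y then p.weight c s else 0 := rfl

@[simp] theorem Path.weight_down {t n : ℕ} (p : Path (t + 1) n) (y : C) (c : Tuple C t)
    (s : Tuple C n) :
    p.down.weight c (Tuple.cons y s) = p.weight (Tuple.cons y c) s := rfl

/-- The path of the composite of the diagram of a path with a cup at the lower points. -/
def Path.cupAt : ∀ {t n : ℕ}, Path (t + 2) n → ℕ → Path t n
  | _, _, .up p, 0 => p.down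
  -- The index is out of range here; the value agrees with `Tuple.ins_nil`, so that
  -- `Path.weight_cupAt` needs no bound on the index.
  | 0, _, .up p, _ + 1 => p.down
  | _ + 1, _, .up p, i + 1 => (p.cupAt i).up
  -- Before bending, the bent point is the last lower point of `p`, so positions counted from the
  -- right shift by one.
  | _, _, .down p, i => (p.cupAt (i + 1)).down
  termination_by _ n => n

theorem Path.cupAt_up_zero {t n : ℕ} (p : Path (t + 1) n) : p.up.cupAt 0 = p.down := by
  cases t <;> simp [Path.cupAt]

theorem Path.cupAt_up_succ {t n : ℕ} (p : Path (t + 2) n) (i : ℕ) :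
    p.up.cupAt (i + 1) = (p.cupAt i).up := by
  simp [Path.cupAt]

theorem Path.cupAt_down {t n : ℕ} (p : Path (t + 3) n) (i : ℕ) :
    p.down.cupAt i = (p.cupAt (i + 1)).down := by
  cases i <;> cases t <;> simp [Path.cupAt]

theorem Path.le {t n : ℕ} (p : Path t n) : t ≤ n := by
  induction p <;> omega

/-- On distinct colours only the identity path has a non-zero weight. -/
theorem Path.weight_of_nodup {r n : ℕ} (u : Path r n) (c : Tuple C n) (hc : c.Nodup) :
    (∀ g, u.weight g c = 0) ∨
      ∃ h : n = r, ∀ g, u.weight g c = if g = h ▸ c then 1 else 0 := by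
  induction u with
  | nil => exact Or.inr ⟨rfl, fun g => (if_pos (Subsingleton.elim (α := Unit) g c)).symm⟩
  | @up t n u ih =>
    induction c using Tuple.cases_cons with
    | h y c =>
    rcases ih c hc.2 with h | ⟨rfl, h⟩
    · left
      intro g
      induction g using Tuple.cases_cons
      simp [h]
    · refine Or.inr ⟨rfl, fun g => ?_⟩
      induction g using Tuple.cases_cons
      simp [h, ite_and]
  | @down t n u ih =>
    induction c using Tuple.cases_cons with
    | h y c =>
    left
    intro g
    rcases ih c hc.2 with h | ⟨rfl, h⟩
    · simp [h]
    · rw [Path.weight_down, h, if_neg]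
      rintro h'
      apply hc.1
      change Tuple.Mem y c
      simp only at h'
      rw [← h']
      exact Or.inl rfl

theorem Path.weight_self {n : ℕ} (u : Path n n) (g c : Tuple C n) :
    u.weight g c = if g = c then 1 else 0 := by
  induction n with
  | zero => cases u; exact (if_pos (Subsingleton.elim (α := Unit) g c)).symm
  | succ n ih =>
    match u with
    | .up u =>
      induction g using Tuple.cases_cons
      induction c using Tuple.cases_cons
      simp [ih, ite_and]
    | .down u => exact absurd u.le (by omega)

variable [Fintype C]

/-- Justifies `Path.cupAt`: composing with a cup means giving its two ends a common colour and
summing over it. No loop can arise, since a monic diagram has no arc between lower points. -/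
theorem Path.weight_cupAt {t n : ℕ} (p : Path (t + 2) n) (i : ℕ) (c : Tuple C t) (s : Tuple C n) :
    (p.cupAt i).weight c s = ∑ d, p.weight (Tuple.ins i c d) s := by
  induction n generalizing t i with
  | zero => nomatch p
  | succ n ih =>
    induction s using Tuple.cases_cons with
    | h y s =>
      match t, p, i, c with
      | t, .up p, 0, c => simp [Path.cupAt_up_zero]
      | 0, .up p, i + 1, c =>
        have : p.up.cupAt (i + 1) = p.down := by simp [Path.cupAt]
        simp [this, Tuple.eq_nil c]
      | t + 1, .up p, i + 1, c =>
        induction c using Tuple.cases_cons with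
        | h x c =>
          simp only [Path.cupAt_up_succ, Path.weight_up, Tuple.ins_succ, ih]
          split_ifs <;> simp
      | t, .down p, i, c => simp [Path.cupAt_down, ih]

/-! ### Contractions of paths are multiples of planar diagrams -/

/-- The contraction of two paths along their upper points. -/
def Path.contract {a b n : ℕ} (p' : Path a n) (p : Path b n) (c' : Tuple C a) (c : Tuple C b) : ℂ :=
  ∑ s, p'.weight c' s * p.weight c s

/-- The contraction of two paths along their lower points. -/
def Path.glue {r a b : ℕ} (u : Path r a) (v : Path r b) (c' : Tuple C a) (c : Tuple C b) : ℂ :=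
  ∑ g, u.weight g c' * v.weight g c

theorem Path.contract_up_up {a b n : ℕ} (p' : Path a n) (p : Path b n) (x y : C) (c' : Tuple C a)
    (c : Tuple C b) : p'.up.contract p.up (Tuple.cons x c') (Tuple.cons y c) =
      if x = y then p'.contract p c' c else 0 := by
  simp only [Path.contract, Tuple.sum_succ, Path.weight_up]
  rw [Finset.sum_eq_single x]
  · by_cases h : x = y
    · simp [h]
    · simp [h, Ne.symm h]
  · intro z _ hz
    simp [hz.symm]
  · simp

theorem Path.contract_comm {a b n : ℕ} (p' : Path a n) (p : Path b n) (c' : Tuple C a)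
    (c : Tuple C b) : p'.contract p c' c = p.contract p' c c' := by
  simp only [Path.contract, mul_comm]

theorem Path.glue_comm {r a b : ℕ} (p' : Path r a) (p : Path r b) (c' : Tuple C a)
    (c : Tuple C b) : p'.glue p c' c = p.glue p' c c' := by
  simp only [Path.glue, mul_comm]

theorem Path.contract_up_down {a b n : ℕ} (p' : Path a n) (p : Path (b + 1) n) (x : C)
    (c' : Tuple C a) (c : Tuple C b) : p'.up.contract p.down (Tuple.cons x c') c =
      p'.contract p c' (Tuple.cons x c) := by
  simp only [Path.contract, Tuple.sum_succ, Path.weight_up, Path.weight_down]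
  rw [Finset.sum_eq_single x]
  · simp
  · intro z _ hz
    simp [hz.symm]
  · simp

theorem Path.contract_down_down {a b n : ℕ} (p' : Path (a + 1) n) (p : Path (b + 1) n)
    (c' : Tuple C a) (c : Tuple C b) : p'.down.contract p.down c' c =
      ∑ z, p'.contract p (Tuple.cons z c') (Tuple.cons z c) := by
  simp only [Path.contract, Tuple.sum_succ, Path.weight_down]

theorem Path.contract_cupAt {a b n : ℕ} (p' : Path a n) (p : Path (b + 2) n) (i : ℕ)
    (c' : Tuple C a) (c : Tuple C b) :
    p'.contract (p.cupAt i) c' c = ∑ d, p'.contract p c' (Tuple.ins i c d) := by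
  simp only [Path.contract, Path.weight_cupAt, Finset.mul_sum]
  rw [Finset.sum_comm]

/-- A matrix of tuples that is a multiple of the matrix of a planar diagram. -/
def IsPlanarMatrix {a b : ℕ} (f : Tuple C a → Tuple C b → ℂ) : Prop :=
  ∃ (k : ℂ) (r : ℕ) (u : Path r a) (v : Path r b), ∀ c' c, f c' c = k * u.glue v c' c

theorem IsPlanarMatrix.flip {a b : ℕ} {f : Tuple C a → Tuple C b → ℂ}
    (h : IsPlanarMatrix f) : IsPlanarMatrix fun c c' => f c' c := by
  obtain ⟨k, r, u, v, h⟩ := h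
  exact ⟨k, r, v, u, fun c c' => (h c' c).trans (by rw [Path.glue_comm])⟩

/-- Rotating the last boundary point to the other side keeps a diagram planar: a through strand
there becomes an arc, and an end of an arc becomes a through strand. -/
theorem IsPlanarMatrix.bend {a b : ℕ} {f : Tuple C a → Tuple C (b + 1) → ℂ}
    (h : IsPlanarMatrix f) {f' : Tuple C (a + 1) → Tuple C b → ℂ}
    (hf : ∀ x c' c, f' (Tuple.cons x c') c = f c' (Tuple.cons x c)) : IsPlanarMatrix f' := by
  obtain ⟨k, r, u, v, h⟩ := h
  match r, v with
  | r + 1, .up v =>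
    refine ⟨k, r, u.down, v, fun c' c => ?_⟩
    induction c' using Tuple.cases_cons with
    | h x c' =>
      rw [hf, h]
      simp only [Path.glue, Tuple.sum_succ, Path.weight_up, Path.weight_down]
      rw [Finset.sum_eq_single x]
      · simp
      · intro z _ hz
        simp [hz]
      · simp
  | r, .down v =>
    refine ⟨k, r + 1, u.up, v, fun c' c => ?_⟩
    induction c' using Tuple.cases_cons with
    | h x c' =>
      rw [hf, h]
      simp only [Path.glue, Tuple.sum_succ, Path.weight_up, Path.weight_down]
      rw [Finset.sum_eq_single (a := x)]
      · simp
      · intro z _ hz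
        simp [hz]
      · simp

theorem Path.sum_glue_up_down {r a b : ℕ} (u : Path r a) (v : Path (r + 2) b) (c' : Tuple C a)
    (c : Tuple C b) : ∑ z, u.up.glue v.down (Tuple.cons z c') (Tuple.cons z c) =
      u.glue (v.cupAt 0) c' c := by
  simp only [Path.glue, Tuple.sum_succ, Path.weight_up, Path.weight_down, Path.weight_cupAt,
    Tuple.ins_zero, Finset.mul_sum]
  rw [Finset.sum_comm (γ := Tuple C r)]
  refine Finset.sum_congr rfl fun z _ => ?_
  rw [Finset.sum_eq_single z]
  · simp
  · intro y _ hy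
    simp [hy]
  · simp

/-- Closing up the last points on both sides. If both lie on through strands these are one strand,
which becomes a loop and gives the factor `Fintype.card C`; otherwise arcs are merely joined. -/
theorem IsPlanarMatrix.trace {a b : ℕ} {f : Tuple C (a + 1) → Tuple C (b + 1) → ℂ}
    (h : IsPlanarMatrix f) :
    IsPlanarMatrix fun c' c => ∑ z, f (Tuple.cons z c') (Tuple.cons z c) := by
  obtain ⟨k, r, u, v, h⟩ := h
  simp only [h, ← Finset.mul_sum]
  match r, u, v with
  | r + 1, .up u, .up v =>
    refine ⟨k * Fintype.card C, r, u, v, fun c' c => ?_⟩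
    have : ∀ z, u.up.glue v.up (Tuple.cons z c') (Tuple.cons z c) = u.glue v c' c := by
      intro z
      simp only [Path.glue, Tuple.sum_succ, Path.weight_up]
      rw [Finset.sum_eq_single z]
      · simp
      · intro y _ hy
        simp [hy]
      · simp
    simp [this, mul_assoc]
  | r + 1, .up u, .down v =>
    exact ⟨k, r, u, v.cupAt 0, fun c' c => congrArg (k * ·) (Path.sum_glue_up_down u v c' c)⟩
  | r + 1, .down u, .up v =>
    refine ⟨k, r, u.cupAt 0, v, fun c' c => ?_⟩
    rw [Path.glue_comm, ← Path.sum_glue_up_down]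
    simp only [Path.glue_comm u.down]
  | r, .down u, .down v =>
    refine ⟨k, r + 1, u, v, fun c' c => ?_⟩
    simp only [Path.glue, Tuple.sum_succ, Path.weight_down]

/-- The last upper points of the two paths are glued one pair at a time; each of the four
combinations of last steps is an extension, a bend or a trace. The cup identities below then need to
be checked only on planar diagrams. -/
theorem Path.isPlanarMatrix_contract {n : ℕ} : ∀ {a b : ℕ} (p' : Path a n) (p : Path b n),
    IsPlanarMatrix (p'.contract p (C := C)) := by
  induction n with
  | zero =>
    intro a b p' p
    match a, b, p', p with
    | _, _, .nil, .nil =>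
      exact ⟨1, 0, .nil, .nil, fun c' c => by simp [Path.contract, Path.glue]⟩
  | succ n ih =>
    intro a b p' p
    match a, b, p', p with
    | a + 1, b + 1, .up p', .up p =>
      obtain ⟨k, r, u, v, h⟩ := ih p' p
      refine ⟨k, r + 1, u.up, v.up, fun c' c => ?_⟩
      induction c' using Tuple.cases_cons with
      | h x c' =>
      induction c using Tuple.cases_cons with
      | h y c =>
        rw [Path.contract_up_up, h]
        simp only [Path.glue, Tuple.sum_succ, Path.weight_up]
        rw [Finset.sum_eq_single x]
        · by_cases hxy : x = y <;> simp [hxy]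
        · intro z _ hz
          simp [hz]
        · simp
    | a + 1, b, .up p', .down p =>
      exact (ih p' p).bend fun x c' c => Path.contract_up_down ..
    | a, b + 1, .down p', .up p =>
      refine ((ih p' p).flip.bend (f' := fun c c' => p'.down.contract p.up c' c) ?_).flip
      intro x c' c
      rw [Path.contract_comm, Path.contract_up_down, Path.contract_comm]
    | a, b, .down p', .down p =>
      have := (ih p' p).trace
      simpa only [← Path.contract_down_down] using this

/-! ### The Jones--Wenzl type cup identities -/

/-- Any cup with `j ≥ 1` leaves the first entry of `c` in front, and this differs from `x`; only the
cup at `j = 0` survives. -/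
theorem cupSum_delta {t : ℕ} (x : C) (c : Tuple C t) (hc : (Tuple.cons x c).Nodup) :
    cupSum (fun e => if e = Tuple.cons x (Tuple.cons x c) then (1 : ℂ) else 0) c =
      qnum (Fintype.card C : ℂ) (t + 1) := by
  rw [cupSum, Finset.sum_eq_single 0]
  · simp
  · intro j hj hj0
    obtain ⟨j, rfl⟩ := Nat.exists_eq_succ_of_ne_zero hj0
    match t, c with
    | 0, _ => simp at hj
    | t + 1, c =>
      induction c using Tuple.cases_cons with
      | h y c =>
      have : y ≠ x := fun h => hc.1 (h ▸ Or.inl rfl)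
      simp [this]
  · simp

/-- The diagram `v` has a single arc, between neighbouring upper points. Since the colours are
distinct, only the cup at the same place (a loop) and its at most two neighbours contribute, and the
sum is an instance of $[m+1]+\delta[m]+[m-1]=0$. -/
theorem qnum_mul_weight_add_cupSum {t : ℕ} (v : Path t (t + 2)) (y : C) (c : Tuple C t)
    (hc : (Tuple.cons y c).Nodup) :
    qnum (Fintype.card C : ℂ) (t + 2) * v.weight c (Tuple.cons y (Tuple.cons y c)) +
      cupSum (v.weight c) c = 0 := by
  induction t generalizing y with
  | zero =>
    match v with
    | .down v =>
      simp [cupSum, Path.weight_self, qnum_add_two]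
  | succ t ih =>
    induction c using Tuple.cases_cons with
    | h x c =>
    have hyx : x ≠ y := fun h => hc.1 (h ▸ Or.inl rfl)
    rw [cupSum, Finset.sum_range_succ']
    match v with
    -- The term with `y` dies because `x ≠ y`; the cup at the last place, forced to have colour `x`,
    -- takes over its role in the induction hypothesis.
    | .up v =>
      have := ih v x c hc.2
      rw [cupSum] at this
      simp only [Path.weight_up, hyx, Tuple.ins_succ, Tuple.ins_zero]
      simp only [Nat.reduceSubDiff, Nat.sub_zero, if_true, if_false, mul_zero, zero_add,
        Finset.sum_ite_eq, Finset.mem_univ]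
      rw [← this]
      ring
    -- The arc is at the right end: the `y` term, the loop and the cup next to it give $[t+3]$,
    -- $N[t+2]$ and $[t+1]$.
    | .down v =>
      have := cupSum_delta x c hc.2
      rw [cupSum] at this
      simp only [Path.weight_down, Path.weight_self, Tuple.ins_succ, Tuple.ins_zero]
      simp only [Nat.reduceSubDiff, Nat.sub_zero]
      simp only [eq_comm (a := Tuple.cons x (Tuple.cons x c)), this]
      simp [qnum_add_two]
      ring

theorem cupSum_contract {a t n : ℕ} (p' : Path a n) (p : Path (t + 2) n) (c' : Tuple C a)
    (c : Tuple C t) : cupSum (p'.contract p c') c =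
      ∑ j ∈ Finset.range (t + 1), qnum (Fintype.card C : ℂ) (t + 1 - j) *
        p'.contract (p.cupAt j) c' c := by
  simp only [cupSum, Path.contract_cupAt]

/-- Orthogonality to all `up` diagrams. After reduction to a planar diagram, distinct colours on the
left leave only through strands there, so what remains on the right has one arc and
`qnum_mul_weight_add_cupSum` applies. -/
theorem cupSum_up_up {t n : ℕ} (p' : Path t n) (p : Path (t + 2) n) (c : Tuple C (t + 1))
    (hc : c.Nodup) : cupSum (p'.up.contract p.up c) c = 0 := by
  induction c using Tuple.cases_cons with
  | h y c =>
  obtain ⟨k, r, u, v, h⟩ := Path.isPlanarMatrix_contract (C := C) p' p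
  simp only [cupSum_cons, Path.contract_up_up, if_true, Finset.sum_ite_eq, Finset.mem_univ, h]
  rw [cupSum_const_mul]
  rcases u.weight_of_nodup c hc.2 with hu | ⟨rfl, hu⟩
  · have : u.glue v c = fun _ => 0 := by
      funext e
      simp [Path.glue, hu]
    simp [this, cupSum]
  · have : u.glue v c = v.weight c := by
      funext e
      simp [Path.glue, hu]
    rw [this, mul_left_comm, ← mul_add, add_comm, qnum_mul_weight_add_cupSum v y c hc, mul_zero]

theorem Path.contract_down_up {a b n : ℕ} (p' : Path (a + 1) n) (p : Path b n) (x : C)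
    (c' : Tuple C a) (c : Tuple C b) : p'.down.contract p.up c' (Tuple.cons x c) =
      p'.contract p (Tuple.cons x c') c := by
  rw [Path.contract_comm, Path.contract_up_down, Path.contract_comm]

/-- The pairing with a `down` diagram. If the last point of the planar half `u` is on a through
strand, then either both sides vanish or `u` is the identity and $N[t+1]+[t]=-[t+2]$ gives the
factor. If it ends an arc, the right side vanishes by distinctness and the left side by the one-arc
identity. -/
theorem cupSum_down_up {t n : ℕ} (p' p : Path (t + 1) n) (y : C) (c : Tuple C t)
    (hc : (Tuple.cons y c).Nodup) : cupSum (p'.down.contract p.up c) c =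
      -qnum (Fintype.card C : ℂ) (t + 2) * p'.contract p (Tuple.cons y c) (Tuple.cons y c) := by
  obtain ⟨k, r, u, v, h⟩ := Path.isPlanarMatrix_contract (C := C) p' p
  match t, r, u, c with
  | 0, _, .up u, c =>
    have hr := u.le
    obtain rfl : _ = 0 := by simpa using hr
    simp [cupSum, Path.contract_down_up, h, Path.glue, Path.weight_self, qnum_add_two]
  | t + 1, _, .up u, c =>
    induction c using Tuple.cases_cons with
    | h x c =>
    simp only [cupSum_cons, Path.contract_down_up, h, cupSum_const_mul]
    rcases u.weight_of_nodup (Tuple.cons x c) hc.2 with hu | ⟨rfl, hu⟩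
    · have : ∀ z, u.up.glue v (Tuple.cons z (Tuple.cons x c)) = fun _ => 0 := by
        intro z
        funext e
        simp [Path.glue, Tuple.sum_succ, hu]
      simp [this, cupSum]
    · have : ∀ z, u.up.glue v (Tuple.cons z (Tuple.cons x c)) =
          fun e => if e = Tuple.cons z (Tuple.cons x c) then 1 else 0 := by
        intro z
        funext e
        simp [Path.glue, Path.weight_self, eq_comm]
      simp only [this, cupSum_delta x c hc.2]
      simp [qnum_add_two]
      ring
  | t + 1, r, .down u, c =>
    induction c using Tuple.cases_cons with
    | h x c =>
    have hyx : y ≠ x := fun h => hc.1 (h ▸ Or.inl rfl)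
    simp only [cupSum_cons, Path.contract_down_up, h, cupSum_const_mul]
    rcases u.weight_of_nodup (Tuple.cons x c) hc.2 with hu | ⟨hr, hu⟩
    · have : ∀ z, u.down.glue v (Tuple.cons z (Tuple.cons x c)) = fun _ => 0 := by
        intro z
        funext e
        simp [Path.glue, hu]
      simp [this, cupSum]
    · obtain rfl : t = r := by omega
      have : ∀ z, u.down.glue v (Tuple.cons z (Tuple.cons x c)) =
          fun e => if z = x then v.weight c e else 0 := by
        intro z
        funext e
        by_cases hz : z = x <;> simp [Path.glue, Path.weight_self, hz]
      have key := qnum_mul_weight_add_cupSum v x c hc.2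
      simp only [this, hyx, if_true, if_false, ← Finset.mul_sum, Finset.sum_ite_eq',
        Finset.mem_univ]
      rw [mul_left_comm, ← mul_add, add_comm, key]
      simp

end Tuples

/-! ### Monic diagrams as lattice paths -/

theorem pos_lt {m n : ℕ} (x : Fin m ⊕ Fin n) : pos x < n := by
  rcases x with i | i <;> simp only [pos] <;> omega

theorem le_pos {m n : ℕ} (x : Fin m ⊕ Fin n) : -(m : ℤ) ≤ pos x := by
  rcases x with i | i <;> simp only [pos] <;> omega

theorem Diagram.mate_injective {m n : ℕ} (D : Diagram m n) : Function.Injective D.mate :=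
  fun x y h => by rw [← D.mate_mate x, h, D.mate_mate]

/-- The inclusion of the points other than the last lower and the last upper one. -/
def inner {m n : ℕ} : Fin m ⊕ Fin n → Fin (m + 1) ⊕ Fin (n + 1) :=
  Sum.map Fin.castSucc Fin.castSucc

@[simp] theorem pos_inner {m n : ℕ} (x : Fin m ⊕ Fin n) : pos (inner x) = pos x := by
  rcases x with i | i <;> simp [pos, inner]

theorem inner_injective {m n : ℕ} : Function.Injective (inner : Fin m ⊕ Fin n → _) :=
  Function.Injective.sumMap (Fin.castSucc_injective _) (Fin.castSucc_injective _)

theorem cases_inner {m n : ℕ} (y : Fin (m + 1) ⊕ Fin (n + 1)) :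
    (∃ x, y = inner x) ∨ y = Sum.inl (Fin.last m) ∨ y = Sum.inr (Fin.last n) := by
  rcases y with i | i
  · induction i using Fin.lastCases with
    | last => simp
    | cast i => exact Or.inl ⟨Sum.inl i, rfl⟩
  · induction i using Fin.lastCases with
    | last => simp
    | cast i => exact Or.inl ⟨Sum.inr i, rfl⟩

/-- Adding a through strand at the right end of a diagram: the involution. -/
def upMate {m n : ℕ} (f : Fin m ⊕ Fin n → Fin m ⊕ Fin n) :
    Fin (m + 1) ⊕ Fin (n + 1) → Fin (m + 1) ⊕ Fin (n + 1) :=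
  Sum.elim
    (Fin.lastCases (Sum.inr (Fin.last n)) fun i => inner (f (Sum.inl i)))
    (Fin.lastCases (Sum.inl (Fin.last m)) fun i => inner (f (Sum.inr i)))

@[simp] theorem upMate_inner {m n : ℕ} (f : Fin m ⊕ Fin n → Fin m ⊕ Fin n) (x : Fin m ⊕ Fin n) :
    upMate f (inner x) = inner (f x) := by
  rcases x with i | i <;> simp [upMate, inner]

@[simp] theorem upMate_inl_last {m n : ℕ} (f : Fin m ⊕ Fin n → Fin m ⊕ Fin n) :
    upMate f (Sum.inl (Fin.last m)) = Sum.inr (Fin.last n) := by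
  simp [upMate]

@[simp] theorem upMate_inr_last {m n : ℕ} (f : Fin m ⊕ Fin n → Fin m ⊕ Fin n) :
    upMate f (Sum.inr (Fin.last n)) = Sum.inl (Fin.last m) := by
  simp [upMate]

theorem pos_inl_last (m n : ℕ) : pos (Sum.inl (Fin.last m) : _ ⊕ Fin n) = -(m : ℤ) - 1 := by
  simp [pos]

theorem pos_inr_last (m n : ℕ) : pos (Sum.inr (Fin.last n) : Fin m ⊕ _) = n := by
  simp [pos]

/-- Adding a through strand at the right end of a diagram. -/
def Diagram.up {m n : ℕ} (D : Diagram m n) : Diagram (m + 1) (n + 1) where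
  mate := upMate D.mate
  mate_mate x := by
    rcases cases_inner x with ⟨x, rfl⟩ | rfl | rfl <;> simp [D.mate_mate]
  mate_ne x := by
    rcases cases_inner x with ⟨x, rfl⟩ | rfl | rfl
    · simpa using fun h => D.mate_ne x (inner_injective h)
    · simp
    · simp
  planar x y := by
    rcases cases_inner x with ⟨x, rfl⟩ | rfl | rfl
    · have h1 := le_pos x
      have h2 := pos_lt (D.mate x)
      rcases cases_inner y with ⟨y, rfl⟩ | rfl | rfl
      · simpa using D.planar x y
      · simp only [upMate_inner, upMate_inl_last, pos_inner, pos_inl_last]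
        omega
      · simp only [upMate_inner, upMate_inr_last, pos_inner, pos_inr_last]
        omega
    · have h := pos_lt (upMate D.mate y)
      simp only [upMate_inl_last, pos_inr_last]
      push_cast at h
      omega
    · simp only [upMate_inr_last, pos_inr_last, pos_inl_last]
      omega

/-- Moving the last lower point to the last place among the upper points. -/
def bend (m n : ℕ) : Fin (m + 1) ⊕ Fin n ≃ Fin m ⊕ Fin (n + 1) where
  toFun := Sum.elim (Fin.lastCases (Sum.inr (Fin.last n)) Sum.inl) (Sum.inr ∘ Fin.castSucc)
  invFun := Sum.elim (Sum.inl ∘ Fin.castSucc) (Fin.lastCases (Sum.inl (Fin.last m)) Sum.inr)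
  left_inv x := by
    rcases x with i | i
    · induction i using Fin.lastCases <;> simp
    · simp
  right_inv x := by
    rcases x with i | i
    · simp
    · induction i using Fin.lastCases <;> simp

@[simp] theorem bend_inl_castSucc {m n : ℕ} (i : Fin m) :
    bend m n (Sum.inl i.castSucc) = Sum.inl i := by simp [bend]

@[simp] theorem bend_inl_last (m n : ℕ) :
    bend m n (Sum.inl (Fin.last m)) = Sum.inr (Fin.last n) := by simp [bend]

@[simp] theorem bend_inr {m n : ℕ} (i : Fin n) :
    bend m n (Sum.inr i) = Sum.inr i.castSucc := by simp [bend]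

@[simp] theorem bend_symm_inl {m n : ℕ} (i : Fin m) :
    (bend m n).symm (Sum.inl i) = Sum.inl i.castSucc := by simp [bend]

@[simp] theorem bend_symm_inr_last (m n : ℕ) :
    (bend m n).symm (Sum.inr (Fin.last n)) = Sum.inl (Fin.last m) := by simp [bend]

@[simp] theorem bend_symm_inr_castSucc {m n : ℕ} (i : Fin n) :
    (bend m n).symm (Sum.inr i.castSucc) = Sum.inr i := by simp [bend]

theorem pos_bend {m n : ℕ} (x : Fin (m + 1) ⊕ Fin n) :
    pos (bend m n x) = pos x ∧ -(m : ℤ) ≤ pos x ∨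
      pos (bend m n x) = n ∧ x = Sum.inl (Fin.last m) ∧ pos x = -(m : ℤ) - 1 := by
  rcases x with i | i
  · induction i using Fin.lastCases with
    | last => exact Or.inr (by simp [pos])
    | cast i =>
      left
      simp only [bend_inl_castSucc, pos, Fin.val_castSucc, true_and]
      omega
  · left
    simp only [bend_inr, pos, Fin.val_castSucc, true_and]
    omega

/-- Moving the last lower point of a diagram to the last place among the upper points. -/
def Diagram.down {m n : ℕ} (D : Diagram (m + 1) n) : Diagram m (n + 1) where
  mate x := bend m n (D.mate ((bend m n).symm x))
  mate_mate x := by simp [D.mate_mate]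
  mate_ne x h := D.mate_ne ((bend m n).symm x) (by simpa using congrArg (bend m n).symm h)
  planar x y := by
    obtain ⟨x, rfl⟩ := (bend m n).surjective x
    obtain ⟨y, rfl⟩ := (bend m n).surjective y
    simp only [Equiv.symm_apply_apply]
    have h1 := D.planar x y
    -- Bending moves the first boundary point to the last place, a cyclic rotation. A crossing in
    -- which `D.mate y` is the moved point is, before bending, a crossing that starts at `D.mate y`.
    have h2 := D.planar (D.mate y) x
    rw [D.mate_mate] at h2
    have := pos_lt x
    have := pos_lt y
    have := pos_lt (D.mate x)
    have := pos_lt (D.mate y)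
    rcases pos_bend x with ⟨hx, _⟩ | ⟨hx, _, _⟩ <;> rcases pos_bend y with ⟨hy, _⟩ | ⟨hy, _, _⟩ <;>
      rcases pos_bend (D.mate x) with ⟨hx', _⟩ | ⟨hx', _, _⟩ <;>
      rcases pos_bend (D.mate y) with ⟨hy', _⟩ | ⟨hy', _, _⟩ <;> omega

/-- Moving the last upper point of a diagram to the last place among the lower points. -/
def Diagram.unbend {m n : ℕ} (D : Diagram m (n + 1)) : Diagram (m + 1) n where
  mate x := (bend m n).symm (D.mate (bend m n x))
  mate_mate x := by simp [D.mate_mate]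
  mate_ne x h := D.mate_ne (bend m n x) (by simpa using congrArg (bend m n) h)
  planar x y := by
    obtain ⟨x', hx'⟩ := (bend m n).surjective (D.mate (bend m n x))
    obtain ⟨y', hy'⟩ := (bend m n).surjective (D.mate (bend m n y))
    simp only [← hx', ← hy', Equiv.symm_apply_apply]
    have h1 := D.planar (bend m n x) (bend m n y)
    -- The inverse rotation: when `x` is the moved point, the old order of the four ends starts at
    -- `y`.
    have h2 := D.planar (bend m n y) (D.mate (bend m n x))
    rw [D.mate_mate, ← hx', ← hy'] at h2
    rw [← hx', ← hy'] at h1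
    have := pos_lt x
    have := pos_lt y
    have := pos_lt x'
    have := pos_lt y'
    rcases pos_bend x with ⟨hx, _⟩ | ⟨hx, _, _⟩ <;> rcases pos_bend y with ⟨hy, _⟩ | ⟨hy, _, _⟩ <;>
      rcases pos_bend x' with ⟨hx', _⟩ | ⟨hx', _, _⟩ <;>
      rcases pos_bend y' with ⟨hy', _⟩ | ⟨hy', _, _⟩ <;> omega

theorem Diagram.down_unbend {m n : ℕ} (D : Diagram m (n + 1)) : D.unbend.down = D := by
  ext x
  simp [Diagram.unbend, Diagram.down]

theorem Diagram.unbend_down {m n : ℕ} (D : Diagram (m + 1) n) : D.down.unbend = D := by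
  ext x
  simp [Diagram.unbend, Diagram.down]

theorem Diagram.up_injective {m n : ℕ} :
    Function.Injective (Diagram.up : Diagram m n → Diagram (m + 1) (n + 1)) := by
  intro D E h
  ext x
  have := congrFun (congrArg Diagram.mate h) (inner x)
  simp only [Diagram.up, upMate_inner] at this
  exact inner_injective this

theorem Diagram.exists_eq_up {m n : ℕ} (D : Diagram (m + 1) (n + 1))
    (h : D.mate (Sum.inr (Fin.last n)) = Sum.inl (Fin.last m)) : ∃ E : Diagram m n, D = E.up := by
  have h' : D.mate (Sum.inl (Fin.last m)) = Sum.inr (Fin.last n) := by rw [← h, D.mate_mate]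
  have key : ∀ x, ∃ y, D.mate (inner x) = inner y := by
    intro x
    rcases cases_inner (D.mate (inner x)) with h1 | h1 | h1
    · exact h1
    · have := D.mate_injective (h1.trans h.symm)
      have h2 := congrArg pos this
      rw [pos_inner, pos_inr_last] at h2
      have := pos_lt x
      omega
    · have := D.mate_injective (h1.trans h'.symm)
      have h2 := congrArg pos this
      rw [pos_inner, pos_inl_last] at h2
      have := le_pos x
      omega
  choose f hf using key
  refine ⟨⟨f, fun x => ?_, fun x hx => ?_, fun x y => ?_⟩, ?_⟩
  · apply inner_injective
    rw [← hf, ← hf, D.mate_mate]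
  · apply D.mate_ne (inner x)
    rw [hf, hx]
  · have := D.planar (inner x) (inner y)
    simpa [hf] using this
  · ext x
    rcases cases_inner x with ⟨x, rfl⟩ | rfl | rfl <;> simp [Diagram.up, hf, h, h']

theorem Diagram.Monic.up {m n : ℕ} {D : Diagram m n} (h : D.Monic) : D.up.Monic := by
  intro i
  induction i using Fin.lastCases with
  | last => exact ⟨Fin.last n, by simp [Diagram.up]⟩
  | cast i =>
    obtain ⟨j, hj⟩ := h i
    refine ⟨j.castSucc, ?_⟩
    have := upMate_inner D.mate (Sum.inl i)
    rw [hj] at this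
    exact this

theorem Diagram.Monic.of_up {m n : ℕ} {D : Diagram m n} (h : D.up.Monic) : D.Monic := by
  intro i
  obtain ⟨j, hj⟩ := h i.castSucc
  have := upMate_inner D.mate (Sum.inl i)
  change D.up.mate (Sum.inl i.castSucc) = _ at this
  rw [hj] at this
  rcases hx : D.mate (Sum.inl i) with k | k
  · rw [hx] at this
    simp [inner] at this
  · exact ⟨k, rfl⟩

theorem Diagram.Monic.down {m n : ℕ} {D : Diagram (m + 1) n} (h : D.Monic) : D.down.Monic := by
  intro i
  obtain ⟨j, hj⟩ := h i.castSucc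
  exact ⟨j.castSucc, by simp [Diagram.down, hj]⟩

theorem Diagram.Monic.unbend {m n : ℕ} {D : Diagram m (n + 1)} (h : D.Monic) {k : Fin (n + 1)}
    (hk : D.mate (Sum.inr (Fin.last n)) = Sum.inr k) : D.unbend.Monic := by
  intro i
  induction i using Fin.lastCases with
  | last =>
    induction k using Fin.lastCases with
    | last => exact absurd hk (D.mate_ne _)
    | cast k => exact ⟨k, by simp [Diagram.unbend, hk]⟩
  | cast i =>
    obtain ⟨j, hj⟩ := h i
    induction j using Fin.lastCases with
    | last =>
      rw [← hj, D.mate_mate] at hk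
      simp at hk
    | cast j => exact ⟨j, by simp [Diagram.unbend, hj]⟩

/-- The last lower point of a monic diagram is joined to the last upper point if the latter is on
a through strand. -/
theorem Diagram.Monic.mate_inr_last {m n : ℕ} {D : Diagram (m + 1) (n + 1)} (h : D.Monic)
    {i : Fin (m + 1)} (hi : D.mate (Sum.inr (Fin.last n)) = Sum.inl i) : i = Fin.last m := by
  by_contra hne
  obtain ⟨j, hj⟩ := h (Fin.last m)
  have h1 := D.planar (Sum.inl (Fin.last m)) (Sum.inl i)
  have hi' : D.mate (Sum.inl i) = Sum.inr (Fin.last n) := by rw [← hi, D.mate_mate]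
  have hj' : j ≠ Fin.last n := by
    rintro rfl
    rw [← hi'] at hj
    exact hne (Sum.inl_injective (D.mate_injective hj)).symm
  rw [hj, hi'] at h1
  have h2 : (i : ℕ) < m := Fin.val_lt_last hne
  have h3 : (j : ℕ) < n := Fin.val_lt_last hj'
  apply h1
  simp only [pos, Fin.val_last]
  omega

/-- The diagram of a path. -/
def Path.diagram : ∀ {t n : ℕ}, Path t n → Diagram t n
  | _, _, .nil => ⟨id, fun _ => rfl, fun x => isEmptyElim x, fun x => isEmptyElim x⟩
  | _, _, .up p => p.diagram.up
  | _, _, .down p => p.diagram.down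

theorem Path.monic_diagram {t n : ℕ} (p : Path t n) : p.diagram.Monic := by
  induction p with
  | nil => exact fun i => isEmptyElim i
  | up p ih => exact ih.up
  | down p ih => exact ih.down

theorem Diagram.down_mate_inr_last {m n : ℕ} {D : Diagram (m + 1) n} (h : D.Monic) :
    ∃ k, D.down.mate (Sum.inr (Fin.last n)) = Sum.inr k := by
  obtain ⟨j, hj⟩ := h (Fin.last m)
  exact ⟨j.castSucc, by simp [Diagram.down, hj]⟩

theorem Path.diagram_injective {t n : ℕ} :
    Function.Injective (Path.diagram : Path t n → Diagram t n) := by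
  induction n generalizing t with
  | zero =>
    intro p p' _
    cases p
    cases p'
    rfl
  | succ n ih =>
    intro p p' h
    match t, p, p' with
    | t + 1, .up p, .up p' => rw [ih (Diagram.up_injective h)]
    | t, .down p, .down p' =>
      have := congrArg Diagram.unbend h
      simp only [Path.diagram, Diagram.unbend_down] at this
      rw [ih this]
    | t + 1, .up p, .down p' =>
      obtain ⟨k, hk⟩ := Diagram.down_mate_inr_last p'.monic_diagram
      have h1 : p.diagram.up = p'.diagram.down := h
      rw [← h1] at hk
      simp [Diagram.up] at hk
    | t + 1, .down p, .up p' =>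
      obtain ⟨k, hk⟩ := Diagram.down_mate_inr_last p.monic_diagram
      have h1 : p.diagram.down = p'.diagram.up := h
      rw [h1] at hk
      simp [Diagram.up] at hk

theorem Path.exists_diagram_eq {t n : ℕ} (D : Diagram t n) (hD : D.Monic) :
    ∃ p : Path t n, p.diagram = D := by
  induction n generalizing t with
  | zero =>
    match t with
    | 0 => exact ⟨.nil, by ext x; exact isEmptyElim x⟩
    | t + 1 => exact (hD 0).elim fun j => j.elim0
  | succ n ih =>
    rcases hx : D.mate (Sum.inr (Fin.last n)) with i | k
    · match t, i with
      | t + 1, i =>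
        obtain rfl := hD.mate_inr_last hx
        obtain ⟨E, rfl⟩ := D.exists_eq_up hx
        obtain ⟨p, rfl⟩ := ih E hD.of_up
        exact ⟨p.up, rfl⟩
    · obtain ⟨p, hp⟩ := ih D.unbend (hD.unbend hx)
      exact ⟨p.down, by rw [Path.diagram, hp, D.down_unbend]⟩

/-- Monic diagrams correspond to paths. -/
noncomputable def Path.equivMonic (t n : ℕ) : Path t n ≃ {D : Diagram t n // D.Monic} :=
  Equiv.ofBijective (fun p => ⟨p.diagram, p.monic_diagram⟩)
    ⟨fun _ _ h => Path.diagram_injective (congrArg Subtype.val h),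
      fun D => (Path.exists_diagram_eq D.1 D.2).imp fun _ h => Subtype.ext h⟩

/-! ### Path weights as indicators of compatible colourings -/

/-- The tuple of the values of a function, the last one first. -/
def Tuple.ofFn {C : Type} : ∀ {n : ℕ}, (Fin n → C) → Tuple C n
  | 0, _ => Tuple.nil
  | n + 1, f => Tuple.cons (f (Fin.last n)) (Tuple.ofFn fun i => f i.castSucc)

theorem Tuple.ofFn_bijective {C : Type} {n : ℕ} :
    Function.Bijective (Tuple.ofFn : (Fin n → C) → Tuple C n) := by
  induction n with
  | zero => exact ⟨fun f g _ => Subsingleton.elim _ _, fun c => ⟨isEmptyElim, rfl⟩⟩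
  | succ n ih =>
    constructor
    · intro f g h
      obtain ⟨h1, h2⟩ := Tuple.cons_inj.1 h
      funext i
      induction i using Fin.lastCases with
      | last => exact h1
      | cast i => exact congrFun (ih.1 h2) i
    · intro c
      induction c using Tuple.cases_cons with
      | h x c =>
      obtain ⟨f, rfl⟩ := ih.2 c
      exact ⟨Fin.snoc (α := fun _ => C) f x, by simp [Tuple.ofFn]⟩

theorem Tuple.mem_ofFn {C : Type} {n : ℕ} (f : Fin n → C) (x : C) :
    Tuple.Mem x (Tuple.ofFn f) ↔ ∃ i, f i = x := by
  induction n with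
  | zero => exact ⟨fun h => h.elim, fun ⟨i, _⟩ => i.elim0⟩
  | succ n ih =>
    rw [Tuple.ofFn, Tuple.mem_cons, ih, Fin.exists_fin_succ']
    rw [or_comm, eq_comm]

theorem Tuple.nodup_ofFn {C : Type} {n : ℕ} (f : Fin n → C) (hf : Function.Injective f) :
    (Tuple.ofFn f).Nodup := by
  induction n with
  | zero => trivial
  | succ n ih =>
    rw [Tuple.ofFn, Tuple.nodup_cons, Tuple.mem_ofFn]
    refine ⟨?_, ih _ (hf.comp (Fin.castSucc_injective n))⟩
    rintro ⟨i, hi⟩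
    exact (Fin.castSucc_lt_last i).ne (hf hi)

open Classical in
theorem Path.weight_ofFn {C : Type} [DecidableEq C] {t n : ℕ} (p : Path t n) (c : Fin t → C)
    (s : Fin n → C) : p.weight (Tuple.ofFn c) (Tuple.ofFn s) =
      if ∀ x, Sum.elim c s (p.diagram.mate x) = Sum.elim c s x then 1 else 0 := by
  induction p with
  | nil => exact (if_pos fun x => isEmptyElim x).symm
  | @up t n p ih =>
    rw [Tuple.ofFn, Tuple.ofFn, Path.weight_up, ih, ← ite_and]
    refine if_congr ⟨?_, ?_⟩ rfl rfl
    · rintro ⟨h1, h2⟩ x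
      have e : ∀ y, Sum.elim c s (inner y) =
          Sum.elim (fun i => c i.castSucc) (fun i => s i.castSucc) y := by
        rintro (y | y) <;> rfl
      rcases cases_inner x with ⟨x, rfl⟩ | rfl | rfl
      · simp [Path.diagram, Diagram.up, e, h2]
      · simp [Path.diagram, Diagram.up, h1]
      · simp [Path.diagram, Diagram.up, h1]
    · intro h
      refine ⟨by simpa [Path.diagram, Diagram.up] using h (Sum.inr (Fin.last n)), fun x => ?_⟩
      have e : ∀ y, Sum.elim (fun i => c i.castSucc) (fun i => s i.castSucc) y =
          Sum.elim c s (inner y) := by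
        rintro (y | y) <;> rfl
      simpa [e, Path.diagram, Diagram.up] using h (inner x)
  | @down t n p ih =>
    have e : ∀ y, Sum.elim (Fin.snoc (α := fun _ => C) c (s (Fin.last n)))
        (fun i => s i.castSucc) y = Sum.elim c s (bend t n y) := by
      rintro (y | y)
      · induction y using Fin.lastCases <;> simp
      · simp
    have := ih (Fin.snoc (α := fun _ => C) c (s (Fin.last n))) fun i => s i.castSucc
    rw [Tuple.ofFn] at this
    simp only [Fin.snoc_last, Fin.snoc_castSucc] at this
    change p.weight (Tuple.cons (s (Fin.last n)) (Tuple.ofFn c))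
      (Tuple.ofFn fun i => s i.castSucc) = _
    rw [this]
    refine if_congr ?_ rfl rfl
    simp only [e, Path.diagram, Diagram.down]
    exact ⟨fun h x => by simpa using h ((bend t n).symm x), fun h x => by simpa using h (bend t n x)⟩

/-! ### Components of stacked pictures as dihedral orbits -/

instance {m n r : ℕ} : Finite (StackPoint m n r) :=
  Finite.of_injective
    (fun u : StackPoint m n r => match u with
      | .lower i => (Sum.inl i : Fin m ⊕ Fin n ⊕ Fin r)
      | .middle j => Sum.inr (Sum.inl j)
      | .upper k => Sum.inr (Sum.inr k))
    (by rintro (i | i | i) (j | j | j) h <;> simp_all)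

/-- The involution of the points of a stacked picture given by the arcs of the lower diagram. -/
def lowStep {m n : ℕ} (r : ℕ) (D : Diagram m n) : StackPoint m n r → StackPoint m n r
  | .lower i => inLower r (D.mate (Sum.inl i))
  | .middle j => inLower r (D.mate (Sum.inr j))
  | .upper k => .upper k

/-- The involution of the points of a stacked picture given by the arcs of the upper diagram. -/
def highStep (m : ℕ) {n r : ℕ} (E : Diagram n r) : StackPoint m n r → StackPoint m n r
  | .lower i => .lower i
  | .middle j => inUpper m (E.mate (Sum.inl j))
  | .upper k => inUpper m (E.mate (Sum.inr k))

theorem lowStep_inLower {m n r : ℕ} (D : Diagram m n) (x : Fin m ⊕ Fin n) :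
    lowStep r D (inLower r x) = inLower r (D.mate x) := by
  rcases x with i | i <;> rfl

theorem highStep_inUpper {m n r : ℕ} (E : Diagram n r) (x : Fin n ⊕ Fin r) :
    highStep m E (inUpper m x) = inUpper m (E.mate x) := by
  rcases x with i | i <;> rfl

theorem inLower_injective {m n r : ℕ} : Function.Injective (inLower r : Fin m ⊕ Fin n → _) := by
  rintro (i | i) (j | j) h <;> simp_all [inLower]

theorem inUpper_injective {m n r : ℕ} : Function.Injective (inUpper m : Fin n ⊕ Fin r → _) := by
  rintro (i | i) (j | j) h <;> simp_all [inUpper]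

theorem lowStep_involutive {m n r : ℕ} (D : Diagram m n) : Function.Involutive (lowStep r D) := by
  rintro (i | i | i)
  · exact (lowStep_inLower D _).trans (by rw [D.mate_mate]; rfl)
  · exact (lowStep_inLower D _).trans (by rw [D.mate_mate]; rfl)
  · rfl

theorem highStep_involutive {m n r : ℕ} (E : Diagram n r) :
    Function.Involutive (highStep m E) := by
  rintro (i | i | i)
  · rfl
  · exact (highStep_inUpper E _).trans (by rw [E.mate_mate]; rfl)
  · exact (highStep_inUpper E _).trans (by rw [E.mate_mate]; rfl)

theorem exists_upper_of_lowStep_eq {m n r : ℕ} (D : Diagram m n) {u : StackPoint m n r}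
    (h : lowStep r D u = u) : ∃ k, u = .upper k := by
  rcases u with i | i | i
  · have h' : inLower r (D.mate (Sum.inl i)) = inLower r (Sum.inl i) := h
    exact absurd (inLower_injective h') (D.mate_ne _)
  · have h' : inLower r (D.mate (Sum.inr i)) = inLower r (Sum.inr i) := h
    exact absurd (inLower_injective h') (D.mate_ne _)
  · exact ⟨i, rfl⟩

theorem exists_lower_of_highStep_eq {m n r : ℕ} (E : Diagram n r) {u : StackPoint m n r}
    (h : highStep m E u = u) : ∃ k, u = .lower k := by
  rcases u with i | i | i
  · exact ⟨i, rfl⟩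
  · have h' : inUpper m (E.mate (Sum.inl i)) = inUpper m (Sum.inl i) := h
    exact absurd (inUpper_injective h') (E.mate_ne _)
  · have h' : inUpper m (E.mate (Sum.inr i)) = inUpper m (Sum.inr i) := h
    exact absurd (inUpper_injective h') (E.mate_ne _)

theorem stack_adj {m n r : ℕ} {E : Diagram n r} {D : Diagram m n} {u v : StackPoint m n r}
    (h : (stack E D).Adj u v) : v = lowStep r D u ∨ v = highStep m E u := by
  rw [stack, SimpleGraph.fromRel_adj] at h
  obtain ⟨-, (⟨x, rfl, rfl⟩ | ⟨x, rfl, rfl⟩) | (⟨x, rfl, rfl⟩ | ⟨x, rfl, rfl⟩)⟩ := h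
  · exact Or.inl (lowStep_inLower D x).symm
  · exact Or.inr (highStep_inUpper E x).symm
  · exact Or.inl (by rw [lowStep_inLower, D.mate_mate])
  · exact Or.inr (by rw [highStep_inUpper, E.mate_mate])

theorem reachable_inLower {m n r : ℕ} (E : Diagram n r) (D : Diagram m n) (x : Fin m ⊕ Fin n) :
    (stack E D).Reachable (inLower r x) (inLower r (D.mate x)) := by
  apply SimpleGraph.Adj.reachable
  rw [stack, SimpleGraph.fromRel_adj]
  exact ⟨fun h => D.mate_ne x (inLower_injective h).symm, Or.inl (Or.inl ⟨x, rfl, rfl⟩)⟩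

theorem reachable_inUpper {m n r : ℕ} (E : Diagram n r) (D : Diagram m n) (x : Fin n ⊕ Fin r) :
    (stack E D).Reachable (inUpper m x) (inUpper m (E.mate x)) := by
  apply SimpleGraph.Adj.reachable
  rw [stack, SimpleGraph.fromRel_adj]
  exact ⟨fun h => E.mate_ne x (inUpper_injective h).symm, Or.inl (Or.inr ⟨x, rfl, rfl⟩)⟩

theorem reachable_lowStep {m n r : ℕ} (E : Diagram n r) (D : Diagram m n) (u : StackPoint m n r) :
    (stack E D).Reachable u (lowStep r D u) := by
  rcases u with i | i | i
  · exact reachable_inLower E D (Sum.inl i)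
  · exact reachable_inLower E D (Sum.inr i)
  · exact SimpleGraph.Reachable.refl _

theorem reachable_highStep {m n r : ℕ} (E : Diagram n r) (D : Diagram m n)
    (u : StackPoint m n r) : (stack E D).Reachable u (highStep m E u) := by
  rcases u with i | i | i
  · exact SimpleGraph.Reachable.refl _
  · exact reachable_inUpper E D (Sum.inl i)
  · exact reachable_inUpper E D (Sum.inr i)

/-- A property that is invariant under both involutions is invariant under reachability. -/
theorem reachable_induction {m n r : ℕ} {E : Diagram n r} {D : Diagram m n}
    {P : StackPoint m n r → Prop} (hlow : ∀ u, P u → P (lowStep r D u))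
    (hhigh : ∀ u, P u → P (highStep m E u)) {u v : StackPoint m n r}
    (h : (stack E D).Reachable u v) (hu : P u) : P v := by
  obtain ⟨w⟩ := h
  induction w with
  | nil => exact hu
  | cons hadj _ ih =>
    rcases stack_adj hadj with rfl | rfl
    · exact ih (hlow _ hu)
    · exact ih (hhigh _ hu)

section Orbit

variable {V : Type*} (a b : Equiv.Perm V)

/-- Two involutions generate a dihedral group: conjugation by one of them inverts the rotation `a *
b`. -/
theorem zpow_mul_left_of_involutive (ha : Function.Involutive a) (hb : Function.Involutive b)
    (k : ℤ) (x : V) : a (((a * b) ^ k) x) = ((a * b) ^ (-k)) (a x) := by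
  have ha' : a * a = 1 := Equiv.ext ha
  have hb' : b * b = 1 := Equiv.ext hb
  have hai : a⁻¹ = a := inv_eq_of_mul_eq_one_left ha'
  have hbi : b⁻¹ = b := inv_eq_of_mul_eq_one_left hb'
  have h : a * (a * b) ^ k * a⁻¹ = (a * b) ^ (-k) := by
    rw [← conj_zpow, zpow_neg, ← inv_zpow]
    congr 1
    rw [mul_inv_rev, hai, hbi, ← mul_assoc, ha', one_mul]
  rw [← h]
  simp

theorem zpow_mul_right_of_involutive (ha : Function.Involutive a) (hb : Function.Involutive b)
    (k : ℤ) (x : V) : b (((a * b) ^ k) x) = ((a * b) ^ (-k)) (b x) := by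
  have h := zpow_mul_left_of_involutive b a hb ha (-k) x
  have ha' : a * a = 1 := Equiv.ext ha
  have hb' : b * b = 1 := Equiv.ext hb
  have hinv : b * a = (a * b)⁻¹ := by
    rw [mul_inv_rev, inv_eq_of_mul_eq_one_left ha', inv_eq_of_mul_eq_one_left hb']
  simpa only [hinv, inv_zpow', neg_neg] using h

end Orbit

/-- The product of the two involutions of a stacked picture. -/
def stackPerm {m n r : ℕ} (E : Diagram n r) (D : Diagram m n) : Equiv.Perm (StackPoint m n r) :=
  (lowStep_involutive D).toPerm * (highStep_involutive E).toPerm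

theorem lowStep_stackPerm_zpow {m n r : ℕ} (E : Diagram n r) (D : Diagram m n) (i : Fin m)
    (k : ℤ) : lowStep r D ((stackPerm E D ^ k) (.lower i)) =
      (stackPerm E D ^ (1 - k)) (.lower i) := by
  have h := zpow_mul_left_of_involutive (lowStep_involutive (r := r) D).toPerm
    (highStep_involutive (m := m) E).toPerm (lowStep_involutive D) (highStep_involutive E) k
    (.lower i)
  rw [sub_eq_neg_add, zpow_add]
  exact h

theorem highStep_stackPerm_zpow {m n r : ℕ} (E : Diagram n r) (D : Diagram m n) (i : Fin m)
    (k : ℤ) : highStep m E ((stackPerm E D ^ k) (.lower i)) =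
      (stackPerm E D ^ (-k)) (.lower i) :=
  zpow_mul_right_of_involutive (lowStep_involutive (r := r) D).toPerm
    (highStep_involutive (m := m) E).toPerm (lowStep_involutive D) (highStep_involutive E) k
    (.lower i)

theorem reachable_stackPerm_zpow {m n r : ℕ} (E : Diagram n r) (D : Diagram m n) (k : ℤ)
    (u : StackPoint m n r) : (stack E D).Reachable u ((stackPerm E D ^ k) u) := by
  have h1 : ∀ u, (stack E D).Reachable u (stackPerm E D u) := fun u =>
    (reachable_highStep E D u).trans (reachable_lowStep E D _)
  induction k using Int.induction_on generalizing u with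
  | zero => exact SimpleGraph.Reachable.refl _
  | succ k ih =>
    rw [zpow_add, zpow_one]
    exact (h1 u).trans (ih _)
  | pred k ih =>
    rw [zpow_sub, zpow_one]
    refine SimpleGraph.Reachable.trans ?_ (ih _)
    have := h1 ((stackPerm E D)⁻¹ u)
    rw [← Equiv.Perm.mul_apply, mul_inv_cancel, Equiv.Perm.one_apply] at this
    exact this.symm

theorem exists_zpow_of_reachable {m n r : ℕ} {E : Diagram n r} {D : Diagram m n} {i : Fin m}
    {v : StackPoint m n r} (h : (stack E D).Reachable (.lower i) v) :
    ∃ k : ℤ, v = (stackPerm E D ^ k) (.lower i) := by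
  refine reachable_induction (P := fun v => ∃ k : ℤ, v = (stackPerm E D ^ k) (.lower i))
    ?_ ?_ h ⟨0, rfl⟩
  · rintro _ ⟨k, rfl⟩
    exact ⟨_, lowStep_stackPerm_zpow E D i k⟩
  · rintro _ ⟨k, rfl⟩
    exact ⟨_, highStep_stackPerm_zpow E D i k⟩

/-- A component of a stacked picture that contains a lower and an upper point contains no other
lower point. -/
theorem eq_of_reachable_lower_upper {m n r : ℕ} {E : Diagram n r} {D : Diagram m n} {i j : Fin m}
    {k : Fin r} (hj : (stack E D).Reachable (.lower i) (.lower j))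
    (hk : (stack E D).Reachable (.lower i) (.upper k)) : i = j := by
  obtain ⟨x, hx⟩ := exists_zpow_of_reachable hj
  obtain ⟨y, hy⟩ := exists_zpow_of_reachable hk
  have h1 := highStep_stackPerm_zpow E D i x
  rw [← hx] at h1
  change StackPoint.lower j = _ at h1
  rw [hx] at h1
  have h2 := lowStep_stackPerm_zpow E D i y
  rw [← hy] at h2
  change StackPoint.upper k = _ at h2
  rw [hy] at h2
  -- Lower points are fixed by `highStep` and upper points by `lowStep`. Reflecting at the second
  -- lower point gives the period `2 * x`, reflecting at the upper point the odd period `2 * y - 1`;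
  -- a combination of the two is `x` itself.
  have m1 : stackPerm E D ^ (2 * x) ∈
      MulAction.stabilizer (Equiv.Perm (StackPoint m n r))
        (StackPoint.lower i : StackPoint m n r) := by
    rw [MulAction.mem_stabilizer_iff, Equiv.Perm.smul_def, two_mul, zpow_add,
      Equiv.Perm.mul_apply, h1, ← Equiv.Perm.mul_apply, ← zpow_add]
    simp
  have m2 : stackPerm E D ^ (2 * y - 1) ∈
      MulAction.stabilizer (Equiv.Perm (StackPoint m n r))
        (StackPoint.lower i : StackPoint m n r) := by
    have e : 2 * y - 1 = -(1 - y) + y := by ring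
    rw [MulAction.mem_stabilizer_iff, Equiv.Perm.smul_def, e, zpow_add,
      Equiv.Perm.mul_apply, h2, ← Equiv.Perm.mul_apply, ← zpow_add]
    simp
  have m3 := mul_mem (zpow_mem m1 y) (zpow_mem m2 (-x))
  rw [← zpow_mul, ← zpow_mul, ← zpow_add] at m3
  have e : 2 * x * y + (2 * y - 1) * -x = x := by ring
  rw [e, MulAction.mem_stabilizer_iff, Equiv.Perm.smul_def, ← hx] at m3
  exact (StackPoint.lower.inj m3).symm

/-- The component of a lower point of a stacked picture contains another boundary point. -/
theorem exists_reachable_boundary {m n r : ℕ} (E : Diagram n r) (D : Diagram m n) (i : Fin m) :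
    (∃ j, j ≠ i ∧ (stack E D).Reachable (.lower i) (.lower j)) ∨
      ∃ k, (stack E D).Reachable (.lower i) (.upper k) := by
  classical
  have hex : ∃ p : ℕ, 0 < p ∧ (stackPerm E D ^ (p : ℤ)) (.lower i) = .lower i := by
    refine ⟨orderOf (stackPerm E D), orderOf_pos _, ?_⟩
    rw [zpow_natCast, pow_orderOf_eq_one]
    rfl
  obtain ⟨hpos, hp⟩ := Nat.find_spec hex
  have hmin := fun q => Nat.find_min hex (m := q)
  set p := Nat.find hex
  have key : ∀ x y : ℤ, x = y + p →
      (stackPerm E D ^ x) (.lower i) = (stackPerm E D ^ y) (.lower i) := by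
    rintro x y rfl
    rw [zpow_add, Equiv.Perm.mul_apply, hp]
  -- Halfway through the minimal period the orbit is fixed by one of the reflections: by `highStep`
  -- if the period is even, which gives a second lower point, and by `lowStep` if it is odd, which
  -- gives an upper point.
  rcases Nat.even_or_odd' p with ⟨q, hq | hq⟩
  · left
    have h := highStep_stackPerm_zpow E D i q
    rw [← key q (-q) (by omega)] at h
    obtain ⟨j, hj⟩ := exists_lower_of_highStep_eq E h
    refine ⟨j, ?_, ?_⟩
    · rintro rfl
      exact hmin q (by omega) ⟨by omega, hj⟩
    · rw [← hj]
      exact reachable_stackPerm_zpow ..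
  · right
    have h := lowStep_stackPerm_zpow E D i (q + 1)
    rw [← key (q + 1) (1 - (q + 1)) (by omega)] at h
    obtain ⟨k, hk⟩ := exists_upper_of_lowStep_eq D h
    refine ⟨k, ?_⟩
    rw [← hk]
    exact reachable_stackPerm_zpow ..

/-! ### Counting common colourings of two diagrams -/

/-- The colouring of the points of a stacked picture with given colours of the points. -/
def stackColor {C : Type} {t n : ℕ} (c : Fin t → C) (s : Fin n → C) : StackPoint t n t → C
  | .lower i => c i
  | .middle j => s j
  | .upper k => c k

theorem stackColor_lowStep {C : Type} {t n : ℕ} {c : Fin t → C} {s : Fin n → C} {D : Diagram t n}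
    (h : ∀ x, Sum.elim c s (D.mate x) = Sum.elim c s x) (u : StackPoint t n t) :
    stackColor c s (lowStep t D u) = stackColor c s u := by
  have e : ∀ x, stackColor c s (inLower t x) = Sum.elim c s x := by rintro (x | x) <;> rfl
  rcases u with i | i | i
  · exact (e _).trans (h (Sum.inl i))
  · exact (e _).trans (h (Sum.inr i))
  · rfl

theorem stackColor_highStep {C : Type} {t n : ℕ} {c : Fin t → C} {s : Fin n → C}
    {D : Diagram t n} (h : ∀ x, Sum.elim c s (D.mate x) = Sum.elim c s x)
    (u : StackPoint t n t) : stackColor c s (highStep t D.star u) = stackColor c s u := by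
  have e : ∀ x : Fin n ⊕ Fin t, stackColor c s (inUpper t x) = Sum.elim c s x.swap := by
    rintro (x | x) <;> rfl
  rcases u with i | i | i
  · rfl
  · refine (e _).trans ?_
    simpa [Diagram.star, stackColor] using h (Sum.inr i)
  · refine (e _).trans ?_
    simpa [Diagram.star, stackColor] using h (Sum.inl i)

theorem stackColor_reachable {C : Type} {t n : ℕ} {c : Fin t → C} {s : Fin n → C}
    {D₁ D₂ : Diagram t n} (h₁ : ∀ x, Sum.elim c s (D₁.mate x) = Sum.elim c s x)
    (h₂ : ∀ x, Sum.elim c s (D₂.mate x) = Sum.elim c s x) {u v : StackPoint t n t}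
    (h : (stack D₁.star D₂).Reachable u v) : stackColor c s v = stackColor c s u := by
  refine reachable_induction (P := fun v => stackColor c s v = stackColor c s u) ?_ ?_ h rfl
  · intro w hw
    rw [stackColor_lowStep h₂, hw]
  · intro w hw
    rw [stackColor_highStep h₁, hw]

/-- If two diagrams have a common colouring with distinct colours of the lower points, then their
product is a multiple of the identity. -/
theorem isMultipleOfId_of_color {C : Type} {t n : ℕ} {c : Fin t → C} (hc : Function.Injective c)
    {s : Fin n → C} {D₁ D₂ : Diagram t n} (h₁ : ∀ x, Sum.elim c s (D₁.mate x) = Sum.elim c s x)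
    (h₂ : ∀ x, Sum.elim c s (D₂.mate x) = Sum.elim c s x) : IsMultipleOfId D₁.star D₂ := by
  intro i
  rcases exists_reachable_boundary D₁.star D₂ i with ⟨j, hj, hr⟩ | ⟨k, hk⟩
  · exact absurd (hc (stackColor_reachable h₁ h₂ hr)) hj
  · obtain rfl := hc (stackColor_reachable h₁ h₂ hk)
    exact hk

/-- The number of common colourings of two diagrams whose product is a multiple of the identity. -/
theorem card_color {C : Type} {t n : ℕ} [Fintype C] (c : Fin t → C)
    {D₁ D₂ : Diagram t n} (hD : IsMultipleOfId D₁.star D₂) :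
    Nat.card {s : Fin n → C // (∀ x, Sum.elim c s (D₁.mate x) = Sum.elim c s x) ∧
      ∀ x, Sum.elim c s (D₂.mate x) = Sum.elim c s x} =
      Fintype.card C ^ loops D₁.star D₂ := by
  classical
  set G := stack D₁.star D₂ with hG
  set K : Set G.ConnectedComponent := {C | ∀ u ∈ C.supp, ∃ j, u = StackPoint.middle j} with hK
  have hex : ∀ X : G.ConnectedComponent, X ∉ K →
      ∃ i, X = G.connectedComponentMk (.lower i) := by
    intro X hX
    simp only [hK, Set.mem_ofPred_eq, not_forall] at hX
    obtain ⟨u, hu, hu'⟩ := hX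
    rw [SimpleGraph.ConnectedComponent.mem_supp_iff] at hu
    rcases u with i | j | i
    · exact ⟨i, hu.symm⟩
    · exact absurd ⟨j, rfl⟩ hu'
    · exact ⟨i, hu.symm.trans (SimpleGraph.ConnectedComponent.sound (hD i).symm)⟩
  have hlow : ∀ i, G.connectedComponentMk (.lower i) ∉ K := by
    intro i hi
    obtain ⟨j, hj⟩ := hi (.lower i) rfl
    cases hj
  choose idx hidx using hex
  have hidx' : ∀ i, idx (G.connectedComponentMk (.lower i)) (hlow i) = i := by
    intro i
    have h := SimpleGraph.ConnectedComponent.exact (hidx _ (hlow i))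
    exact (eq_of_reachable_lower_upper h (hD i)).symm
  -- A colouring is constant on components: it is free on each loop, and every other component
  -- contains exactly one lower point, which dictates its colour.
  let col (g : K → C) (X : G.ConnectedComponent) : C :=
    if h : X ∈ K then g ⟨X, h⟩ else c (idx X h)
  have hcol : ∀ g i, col g (G.connectedComponentMk (.lower i)) = c i := by
    intro g i
    simp only [col, dif_neg (hlow i), hidx']
  have hcol' : ∀ g i, col g (G.connectedComponentMk (.upper i)) = c i := by
    intro g i
    rw [← hcol g i, SimpleGraph.ConnectedComponent.sound (hD i)]
  let s (g : K → C) (j : Fin n) : C := col g (G.connectedComponentMk (.middle j))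
  have hs₂ : ∀ g x, Sum.elim c (s g) (D₂.mate x) = Sum.elim c (s g) x := by
    intro g x
    have e : ∀ x, Sum.elim c (s g) x = col g (G.connectedComponentMk (inLower t x)) := by
      rintro (x | x)
      · exact (hcol g x).symm
      · rfl
    rw [e, e, SimpleGraph.ConnectedComponent.sound (reachable_inLower D₁.star D₂ x)]
  have hs₁ : ∀ g x, Sum.elim c (s g) (D₁.mate x) = Sum.elim c (s g) x := by
    intro g x
    have e : ∀ x : Fin t ⊕ Fin n,
        Sum.elim c (s g) x = col g (G.connectedComponentMk (inUpper t x.swap)) := by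
      rintro (x | x)
      · exact (hcol' g x).symm
      · rfl
    have hx : D₁.star.mate x.swap = (D₁.mate x).swap := by simp [Diagram.star]
    rw [e, e, SimpleGraph.ConnectedComponent.sound (reachable_inUpper D₁.star D₂ x.swap), hx]
  let Φ (g : K → C) : {s : Fin n → C // (∀ x, Sum.elim c s (D₁.mate x) = Sum.elim c s x) ∧
      ∀ x, Sum.elim c s (D₂.mate x) = Sum.elim c s x} := ⟨s g, hs₁ g, hs₂ g⟩
  have hΦ : Function.Bijective Φ := by
    constructor
    · intro g g' h
      funext X
      obtain ⟨X, hX⟩ := X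
      induction X using SimpleGraph.ConnectedComponent.ind with
      | h u =>
      obtain ⟨j, rfl⟩ := hX u rfl
      have := congrFun (congrArg Subtype.val h) j
      simpa only [Φ, s, col, dif_pos hX] using this
    · rintro ⟨f, hf₁, hf₂⟩
      refine ⟨fun X => stackColor c f X.1.out, Subtype.ext (funext fun j => ?_)⟩
      change (if h : _ then _ else _) = _
      split_ifs with h
      · have : G.connectedComponentMk (G.connectedComponentMk (.middle j)).out =
            G.connectedComponentMk (.middle j) := Quot.out_eq _
        exact (stackColor_reachable hf₁ hf₂ (SimpleGraph.ConnectedComponent.exact this)).symm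
      · have := SimpleGraph.ConnectedComponent.exact (hidx _ h)
        exact stackColor_reachable hf₁ hf₂ this
  rw [← Nat.card_eq_of_bijective Φ hΦ, Nat.card_fun, Nat.card_eq_fintype_card]
  rfl

/-! ### The form as a polynomial in the loop parameter -/

open Classical in
/-- The value of the form on two diagrams as a polynomial in the loop parameter. -/
noncomputable def formPoly {t n : ℕ} (p' p : Path t n) : ℂ[X] :=
  if IsMultipleOfId p'.diagram.star p.diagram then
    Polynomial.X ^ loops p'.diagram.star p.diagram else 0

theorem eval_formPoly_quantum (q : ℂ) {t n : ℕ} (p' p : Path t n) :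
    (formPoly p' p).eval (-(q + q⁻¹)) = diagramForm q p'.diagram p.diagram := by
  rw [formPoly, diagramForm]
  split_ifs <;> simp

/-- Distinct lower colours make the colour count vanish unless the product is a multiple of the
identity; otherwise each loop contributes a free choice of colour. -/
theorem eval_formPoly_card {C : Type} [Fintype C] [DecidableEq C] {t n : ℕ} (p' p : Path t n)
    (c : Fin t → C) (hc : Function.Injective c) :
    (formPoly p' p).eval (Fintype.card C : ℂ) =
      p'.contract p (Tuple.ofFn c) (Tuple.ofFn c) := by
  classical
  rw [Path.contract, ← Tuple.ofFn_bijective.sum_comp]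
  simp only [Path.weight_ofFn]
  have : ∀ s : Fin n → C, ((if ∀ x, Sum.elim c s (p'.diagram.mate x) = Sum.elim c s x
      then (1 : ℂ) else 0) * if ∀ x, Sum.elim c s (p.diagram.mate x) = Sum.elim c s x
      then 1 else 0) = if (∀ x, Sum.elim c s (p'.diagram.mate x) = Sum.elim c s x) ∧
      ∀ x, Sum.elim c s (p.diagram.mate x) = Sum.elim c s x then 1 else 0 := by
    intro s
    rw [ite_and]
    split_ifs <;> simp
  simp only [this]
  rw [Finset.sum_boole, ← Fintype.card_subtype, formPoly]
  split_ifs with h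
  · have := card_color (C := C) c h
    rw [Nat.card_eq_fintype_card] at this
    rw [this]
    simp
  · have : IsEmpty {s : Fin n → C // (∀ x, Sum.elim c s (p'.diagram.mate x) = Sum.elim c s x) ∧
        ∀ x, Sum.elim c s (p.diagram.mate x) = Sum.elim c s x} :=
      ⟨fun s => h (isMultipleOfId_of_color hc s.2.1 s.2.2)⟩
    rw [Fintype.card_eq_zero_iff.2 this]
    simp

theorem map_qnum {R S : Type*} [CommRing R] [CommRing S] (φ : R →+* S) (δ : R) (m : ℕ) :
    φ (qnum δ m) = qnum (φ δ) m := by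
  induction m using Nat.strong_induction_on with
  | _ m ih =>
    match m with
    | 0 => simp
    | 1 => simp
    | m + 2 => simp [qnum_add_two, ih (m + 1) (by omega), ih m (by omega)]

theorem eval_qnum {R : Type*} [CommRing R] (z : R) (m : ℕ) :
    (qnum (Polynomial.X : R[X]) m).eval z = qnum z m := by
  rw [← Polynomial.coe_evalRingHom, map_qnum]
  simp

/-- Quantum integers as polynomials in the loop parameter. -/
noncomputable abbrev qpoly (m : ℕ) : ℂ[X] := qnum Polynomial.X m

/-- The bound `M` leaves room for an injective colouring of the lower points. -/
theorem polynomial_eq_of_eval_card {P Q : ℂ[X]} (M : ℕ)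
    (h : ∀ N : ℕ, M ≤ N → P.eval (Fintype.card (Fin N) : ℂ) = Q.eval (Fintype.card (Fin N) : ℂ)) :
    P = Q := by
  apply Polynomial.eq_of_infinite_eval_eq
  refine ((Set.Ici_infinite M).image (f := fun N : ℕ => (N : ℂ))
    Nat.cast_injective.injOn).mono ?_
  rintro _ ⟨N, hN, rfl⟩
  have := h N hN
  rwa [Fintype.card_fin] at this

theorem formPoly_comm {t n : ℕ} (p' p : Path t n) : formPoly p' p = formPoly p p' := by
  refine polynomial_eq_of_eval_card t fun N hN => ?_
  rw [eval_formPoly_card p' p _ (Fin.castLE_injective hN),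
    eval_formPoly_card p p' _ (Fin.castLE_injective hN), Path.contract_comm]

theorem formPoly_up_up {t n : ℕ} (p' p : Path t n) : formPoly p'.up p.up = formPoly p' p := by
  refine polynomial_eq_of_eval_card (t + 1) fun N hN => ?_
  rw [eval_formPoly_card _ _ _ (Fin.castLE_injective hN),
    eval_formPoly_card _ _ _ ((Fin.castLE_injective hN).comp (Fin.castSucc_injective t)),
    Tuple.ofFn, Path.contract_up_up, if_pos rfl]
  rfl

theorem sum_formPoly_up {t n : ℕ} (p' : Path t n) (p : Path (t + 2) n) :
    ∑ j ∈ Finset.range (t + 2), qpoly (t + 2 - j) *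
      formPoly p'.up (p.up.cupAt j) = 0 := by
  refine polynomial_eq_of_eval_card (t + 1) fun N hN => ?_
  have hc := Fin.castLE_injective hN
  simp only [Polynomial.eval_finsetSum, Polynomial.eval_mul, eval_qnum,
    eval_formPoly_card _ _ _ hc, Polynomial.eval_zero]
  rw [← cupSum_up_up p' p _ (Tuple.nodup_ofFn _ hc), cupSum_contract]

theorem sum_formPoly_down {t n : ℕ} (p' p : Path (t + 1) n) :
    ∑ j ∈ Finset.range (t + 1), qpoly (t + 1 - j) *
      formPoly p'.down (p.up.cupAt j) = -qpoly (t + 2) * formPoly p' p := by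
  refine polynomial_eq_of_eval_card (t + 1) fun N hN => ?_
  have hc := Fin.castLE_injective hN
  have hc' := hc.comp (Fin.castSucc_injective t)
  simp only [Polynomial.eval_finsetSum, Polynomial.eval_mul, Polynomial.eval_neg, eval_qnum,
    eval_formPoly_card _ _ _ hc, eval_formPoly_card _ _ _ hc']
  have := cupSum_down_up p' p (Fin.castLE hN (Fin.last t))
    (Tuple.ofFn (Fin.castLE hN ∘ Fin.castSucc)) (Tuple.nodup_ofFn _ hc)
  rw [cupSum_contract] at this
  exact this

/-! ### Gram matrices and their block form -/

instance (t n : ℕ) : Finite (Path t n) := Finite.of_equiv _ (Path.equivMonic t n).symm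

noncomputable instance (t n : ℕ) : Fintype (Path t n) := Fintype.ofFinite _

noncomputable instance (t n : ℕ) : DecidableEq (Path t n) := Classical.decEq _

/-- Paths to a positive height end with a step up or a step down. -/
def Path.equivSum (t n : ℕ) : Path t n ⊕ Path (t + 2) n ≃ Path (t + 1) (n + 1) where
  toFun := Sum.elim Path.up Path.down
  invFun := fun
    | .up p => Sum.inl p
    | .down p => Sum.inr p
  left_inv := by rintro (p | p) <;> rfl
  right_inv := fun
    | .up _ => rfl
    | .down _ => rfl

/-- Paths of positive length to height zero end with a step down. -/
def Path.equivDown (n : ℕ) : Path 1 n ≃ Path 0 (n + 1) where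
  toFun := Path.down
  invFun := fun | .down p => p
  left_inv _ := rfl
  right_inv := fun | .down _ => rfl

/-- The Gram matrix of the form, with polynomial entries. -/
noncomputable def gram (t n : ℕ) : Matrix (Path t n) (Path t n) ℂ[X] := Matrix.of formPoly

theorem gram_transpose (t n : ℕ) : (gram t n).transpose = gram t n :=
  Matrix.ext fun p p' => formPoly_comm p' p

/-- The mixed block of the Gram matrix. -/
noncomputable def mixedGram (t n : ℕ) : Matrix (Path t n) (Path (t + 2) n) ℂ[X] :=
  Matrix.of fun p' p => formPoly p'.up p.down

/-- The lower right block of the Gram matrix. -/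
noncomputable def downGram (t n : ℕ) : Matrix (Path (t + 1) n) (Path (t + 1) n) ℂ[X] :=
  Matrix.of fun p' p => formPoly p'.down p.down

/-- The matrix of the cups that do not involve the last upper point. -/
noncomputable def cupMatrix (t n : ℕ) : Matrix (Path t n) (Path (t + 2) n) ℂ[X] :=
  Matrix.of fun r p => ∑ j ∈ Finset.range (t + 1),
    if r = p.cupAt j then qpoly (t + 1 - j) else 0

theorem gram_submatrix (t n : ℕ) :
    (gram (t + 1) (n + 1)).submatrix (Path.equivSum t n) (Path.equivSum t n) =
      Matrix.fromBlocks (gram t n) (mixedGram t n) (mixedGram t n).transpose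
        (downGram (t + 1) n) := by
  ext (p' | p') (p | p)
  · exact congrArg (Polynomial.coeff · _) (formPoly_up_up p' p)
  · rfl
  · exact congrArg (Polynomial.coeff · _) (formPoly_comm p'.down p.up)
  · rfl

theorem sum_mul_cupMatrix {t n : ℕ} (f : Path t n → ℂ[X]) (p : Path (t + 2) n) :
    ∑ r, f r * cupMatrix t n r p =
      ∑ j ∈ Finset.range (t + 1), qpoly (t + 1 - j) * f (p.cupAt j) := by
  simp only [cupMatrix, Matrix.of_apply, Finset.mul_sum]
  rw [Finset.sum_comm]
  refine Finset.sum_congr rfl fun j _ => ?_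
  simp [mul_comm]

theorem gram_mul_cupMatrix (t n : ℕ) :
    gram t n * cupMatrix t n + qpoly (t + 2) • mixedGram t n = 0 := by
  refine Matrix.ext fun p' p => ?_
  rw [Matrix.add_apply, Matrix.mul_apply, sum_mul_cupMatrix, Matrix.smul_apply, Matrix.zero_apply,
    ← sum_formPoly_up p' p, Finset.sum_range_succ' _ (t + 1)]
  simp [Path.cupAt_up_succ, Path.cupAt_up_zero, formPoly_up_up, gram, mixedGram]

theorem mixedGram_transpose_mul_cupMatrix (t n : ℕ) :
    (mixedGram t n).transpose * cupMatrix t n + qpoly (t + 2) • downGram (t + 1) n =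
      -qpoly (t + 3) • gram (t + 2) n := by
  refine Matrix.ext fun p' p => ?_
  have := sum_formPoly_down p' p
  rw [Finset.sum_range_succ'] at this
  rw [Matrix.add_apply, Matrix.mul_apply, sum_mul_cupMatrix, Matrix.smul_apply]
  simp only [Path.cupAt_up_succ, Path.cupAt_up_zero] at this
  simpa [gram, mixedGram, downGram, formPoly_comm (Path.up _)] using this

theorem gram_zero_succ (n : ℕ) :
    (gram 0 (n + 1)).submatrix (Path.equivDown n) (Path.equivDown n) =
      (Polynomial.X : ℂ[X]) • gram 1 n := by
  refine Matrix.ext fun p' p => ?_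
  have := sum_formPoly_down p' p
  change formPoly p'.down p.down = (Polynomial.X : ℂ[X]) • formPoly p' p
  simpa [Path.cupAt_up_zero, qnum_add_two] using this

/-- The change of basis that makes the Gram matrix block triangular. -/
noncomputable def gramBasis (t n : ℕ) :
    Matrix (Path t n ⊕ Path (t + 2) n) (Path t n ⊕ Path (t + 2) n) ℂ[X] :=
  Matrix.fromBlocks 1 (cupMatrix t n) 0 (qpoly (t + 2) • 1)

theorem gram_mul_gramBasis (t n : ℕ) :
    (gram (t + 1) (n + 1)).submatrix (Path.equivSum t n) (Path.equivSum t n) * gramBasis t n =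
      Matrix.fromBlocks (gram t n) 0 (mixedGram t n).transpose
        (-qpoly (t + 3) • gram (t + 2) n) := by
  rw [gram_submatrix, gramBasis, Matrix.fromBlocks_multiply]
  simp [gram_mul_cupMatrix, mixedGram_transpose_mul_cupMatrix]

/-- The corrected vectors are orthogonal to the `up` part, so the congruence diagonalises the
blocks; the extra factor `qpoly (t + 2)` is the coefficient of the `down` diagram in such a vector.
-/
theorem gramBasis_mul_gram_mul_gramBasis (t n : ℕ) :
    (gramBasis t n).transpose *
      ((gram (t + 1) (n + 1)).submatrix (Path.equivSum t n) (Path.equivSum t n) *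
        gramBasis t n) =
      Matrix.fromBlocks (gram t n) 0 0
        (qpoly (t + 2) • (-qpoly (t + 3) • gram (t + 2) n)) := by
  have h := congrArg Matrix.transpose (gram_mul_cupMatrix t n)
  rw [Matrix.transpose_add, Matrix.transpose_mul, gram_transpose, Matrix.transpose_smul,
    Matrix.transpose_zero] at h
  rw [gram_mul_gramBasis, gramBasis, Matrix.fromBlocks_transpose, Matrix.fromBlocks_multiply]
  simp [h, smul_comm (qpoly (t + 3))]

theorem det_gramBasis (t n : ℕ) :
    (gramBasis t n).det = qpoly (t + 2) ^ Fintype.card (Path (t + 2) n) := by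
  rw [gramBasis, Matrix.det_fromBlocks_zero₂₁]
  simp

theorem det_gram_succ (t n : ℕ) :
    (gram (t + 1) (n + 1)).det * qpoly (t + 2) ^ Fintype.card (Path (t + 2) n) =
      (gram t n).det * ((-qpoly (t + 3)) ^ Fintype.card (Path (t + 2) n) *
        (gram (t + 2) n).det) := by
  have h := congrArg Matrix.det (gram_mul_gramBasis t n)
  rwa [Matrix.det_mul, Matrix.det_submatrix_equiv_self, det_gramBasis,
    Matrix.det_fromBlocks_zero₁₂, Matrix.det_smul] at h

theorem det_gram_zero_succ (n : ℕ) :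
    (gram 0 (n + 1)).det = Polynomial.X ^ Fintype.card (Path 1 n) * (gram 1 n).det := by
  rw [← Matrix.det_submatrix_equiv_self (Path.equivDown n), gram_zero_succ, Matrix.det_smul]

/-! ### Ranks of the specialised Gram matrices -/

theorem finrank_submodule_prod {K V W : Type*} [Field K] [AddCommGroup V] [Module K V]
    [AddCommGroup W] [Module K W] [FiniteDimensional K V] [FiniteDimensional K W]
    (p : Submodule K V) (q : Submodule K W) :
    Module.finrank K (p.prod q) = Module.finrank K p + Module.finrank K q := by
  let e : p.prod q ≃ₗ[K] p × q :=
    { toFun := fun x => (⟨x.1.1, x.2.1⟩, ⟨x.1.2, x.2.2⟩)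
      invFun := fun x => ⟨(x.1.1, x.2.1), x.1.2, x.2.2⟩
      map_add' := fun _ _ => rfl
      map_smul' := fun _ _ => rfl
      left_inv := fun _ => rfl
      right_inv := fun _ => rfl }
  rw [e.finrank_eq, Module.finrank_prod]

theorem rank_fromBlocks_diagonal {K : Type*} [Field K] {m n m' n' : Type*} [Fintype m] [Fintype n]
    [Fintype m'] [Fintype n'] (A : Matrix m m' K) (D : Matrix n n' K) :
    (Matrix.fromBlocks A 0 0 D).rank = A.rank + D.rank := by
  have h : (Matrix.fromBlocks A 0 0 D).mulVecLin =
      (LinearEquiv.sumArrowLequivProdArrow m n K K).symm.toLinearMap ∘ₗ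
        (A.mulVecLin.prodMap D.mulVecLin) ∘ₗ
        (LinearEquiv.sumArrowLequivProdArrow m' n' K K).toLinearMap := by
    refine LinearMap.ext fun v => ?_
    ext (i | i) <;> simp [Matrix.fromBlocks_mulVec] <;> rfl
  rw [Matrix.rank, h, LinearMap.range_comp, LinearEquiv.finrank_map_eq, LinearMap.range_comp,
    LinearEquiv.range, Submodule.map_top, LinearMap.range_prodMap,
    finrank_submodule_prod]
  rfl

/-- The Gram matrix at a given loop parameter. -/
noncomputable def gramAt (z : ℂ) (t n : ℕ) : Matrix (Path t n) (Path t n) ℂ :=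
  (gram t n).map (Polynomial.evalRingHom z)

/-- Non-vanishing of $[t+2]$ makes the base change invertible at `z`; the second block is then a
multiple of the Gram matrix for $t+2$, and is zero exactly when counted as such if $[t+3]=0$. -/
theorem rank_gramAt_succ (z : ℂ) (t n : ℕ) (hz : qnum z (t + 2) ≠ 0) :
    (gramAt z (t + 1) (n + 1)).rank =
      (gramAt z t n).rank + if qnum z (t + 3) = 0 then 0 else (gramAt z (t + 2) n).rank := by
  have h := congrArg (Matrix.map · (Polynomial.evalRingHom z)) (gramBasis_mul_gram_mul_gramBasis t n)
  simp only [Matrix.map_mul, ← Matrix.submatrix_map,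
    Matrix.fromBlocks_map] at h
  have hdet : ((gramBasis t n).map (Polynomial.evalRingHom z)).det ≠ 0 := by
    have := RingHom.map_det (Polynomial.evalRingHom z) (gramBasis t n)
    rw [RingHom.mapMatrix_apply] at this
    rw [← this, det_gramBasis, map_pow, Polynomial.coe_evalRingHom, eval_qnum]
    exact pow_ne_zero _ hz
  have h' := congrArg Matrix.rank h
  rw [Matrix.rank_mul_eq_right_of_isUnit_det _ _ (by
      rw [Matrix.transpose_map, Matrix.det_transpose]
      exact hdet.isUnit), Matrix.rank_mul_eq_left_of_isUnit_det _ _ hdet.isUnit,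
    Matrix.rank_submatrix] at h'
  refine h'.trans ?_
  have e : (qpoly (t + 2) • (-qpoly (t + 3) • gram (t + 2) n)).map
      (Polynomial.evalRingHom z) =
      (qnum z (t + 2) * -qnum z (t + 3)) • gramAt z (t + 2) n := by
    refine Matrix.ext fun i j => ?_
    simp [gramAt, eval_qnum, mul_assoc]
  simp only [Matrix.map_zero _ (map_zero _), e]
  rw [rank_fromBlocks_diagonal, gramAt]
  congr 1
  split_ifs with h3
  · simp [h3]
  · exact Matrix.rank_smul_of_mem_nonZeroDivisors _
      (mem_nonZeroDivisors_of_ne_zero (mul_ne_zero hz (neg_ne_zero.2 h3)))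

theorem rank_gramAt_zero_succ (z : ℂ) (n : ℕ) (hz : z ≠ 0) :
    (gramAt z 0 (n + 1)).rank = (gramAt z 1 n).rank := by
  have h := congrArg (Matrix.map · (Polynomial.evalRingHom z)) (gram_zero_succ n)
  simp only [← Matrix.submatrix_map] at h
  have h' := congrArg Matrix.rank h
  rw [Matrix.rank_submatrix] at h'
  refine h'.trans ?_
  have e : ((Polynomial.X : ℂ[X]) • gram 1 n).map (Polynomial.evalRingHom z) =
      z • gramAt z 1 n := by
    refine Matrix.ext fun i j => ?_
    simp [gramAt]
  rw [e]
  exact Matrix.rank_smul_of_mem_nonZeroDivisors _ (mem_nonZeroDivisors_of_ne_zero hz)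

theorem finrank_cellHead (q : ℂ) (t n : ℕ) :
    Module.finrank ℂ (CellHead q t n) = (gramAt (-(q + q⁻¹)) t n).rank := by
  classical
  have : Fintype {D : Diagram t n // D.Monic} := Fintype.ofFinite _
  let b : Module.Basis {D : Diagram t n // D.Monic} ℂ (CellModule t n) := Finsupp.basisSingleOne
  refine (cellForm q t n).quotKerEquivRange.finrank_eq.trans ?_
  rw [← Matrix.rank_submatrix (gramAt (-(q + q⁻¹)) t n) (Path.equivMonic t n).symm
      (Path.equivMonic t n).symm, ← Matrix.rank_transpose,
    Matrix.rank_eq_finrank_range_toLin _ b.dualBasis b]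
  have e : ((gramAt (-(q + q⁻¹)) t n).submatrix (Path.equivMonic t n).symm
      (Path.equivMonic t n).symm).transpose = LinearMap.toMatrix b b.dualBasis (cellForm q t n) := by
    refine Matrix.ext fun D₁ D₂ => ?_
    rw [LinearMap.toMatrix_apply, Module.Basis.dualBasis_repr]
    obtain ⟨p₁, rfl⟩ := (Path.equivMonic t n).surjective D₁
    obtain ⟨p₂, rfl⟩ := (Path.equivMonic t n).surjective D₂
    have hb : ∀ D, b D = Finsupp.single D 1 := fun D => by simp [b]
    rw [hb, hb, cellForm_single_single, Matrix.transpose_apply, Matrix.submatrix_apply,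
      Equiv.symm_apply_apply, Equiv.symm_apply_apply]
    exact eval_formPoly_quantum q p₂ p₁
  rw [e, Matrix.toLin_toMatrix]

/-! ### Quantum integers at a root of unity -/

theorem qnum_add_add_one {R : Type*} [CommRing R] (δ : R) (m n : ℕ) :
    qnum δ (m + n + 1) = qnum δ (m + 1) * qnum δ (n + 1) - qnum δ m * qnum δ n := by
  induction m using Nat.strong_induction_on with
  | _ m ih =>
    match m with
    | 0 => simp
    | 1 => simp [add_comm 1 n, qnum_add_two]
    | m + 2 =>
      have h1 := ih (m + 1) (by omega)
      have h2 := ih m (by omega)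
      have e : m + 2 + n + 1 = (m + n + 1) + 2 := by omega
      have e' : m + 1 + n + 1 = (m + n + 1) + 1 := by omega
      rw [e'] at h1
      rw [e, qnum_add_two, h1, h2, qnum_add_two δ (m + 1), qnum_add_two δ m]
      ring

theorem qnum_cassini {R : Type*} [CommRing R] (δ : R) (k : ℕ) :
    qnum δ (k + 1) ^ 2 - qnum δ k * qnum δ (k + 2) = 1 := by
  induction k with
  | zero => simp
  | succ k ih =>
    rw [← ih, qnum_add_two δ (k + 1), qnum_add_two δ k]
    ring

/-- Quantum integers of multiples of `k + 1`. -/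
theorem qnum_mul_succ {R : Type*} [CommRing R] (δ : R) (k s : ℕ) :
    qnum δ (s * (k + 1)) = qnum δ (k + 1) * qnum (-(qnum δ (k + 2) - qnum δ k)) s := by
  induction s using Nat.strong_induction_on with
  | _ s ih =>
    match s with
    | 0 => simp
    | 1 => simp
    | s + 2 =>
      have h1 := ih (s + 1) (by omega)
      have h2 := ih s (by omega)
      rw [qnum_add_two]
      set m := s * (k + 1)
      have e1 : (s + 1) * (k + 1) = m + k + 1 := by simp only [m]; ring
      have e2 : (s + 2) * (k + 1) = (m + k + 1) + k + 1 := by simp only [m]; ring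
      have e3 : m + k + 1 + 1 = m + (k + 1) + 1 := by omega
      rw [e1] at h1
      have h3 : qnum δ ((s + 2) * (k + 1)) =
          (qnum δ (k + 2) - qnum δ k) * qnum δ (m + k + 1) - qnum δ m := by
        rw [e2, qnum_add_add_one δ (m + k + 1) k, e3, qnum_add_add_one δ m (k + 1),
          qnum_add_add_one δ m k]
        linear_combination -qnum δ m * qnum_cassini δ k
      rw [h3, h1, h2]
      ring

/-- The case $q=x=\pm1$; the exponent `s + 1` replaces `s - 1`, which is harmless as $x^2=1$. -/
theorem qnum_neg_two_mul {R : Type*} [CommRing R] {x : R} (hx : x ^ 2 = 1) (s : ℕ) :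
    qnum (-(2 * x)) s = s * x ^ (s + 1) := by
  induction s using Nat.strong_induction_on with
  | _ s ih =>
    match s with
    | 0 => simp
    | 1 => simp [hx]
    | s + 2 =>
      rw [qnum_add_two, ih (s + 1) (by omega), ih s (by omega)]
      push_cast
      linear_combination (s * x ^ (s + 1)) * hx

theorem qpoly_ne_zero {m : ℕ} (hm : m ≠ 0) : qpoly m ≠ 0 := by
  intro h
  have h1 := eval_qnum (-(2 * 1) : ℂ) m
  rw [qnum_neg_two_mul (one_pow 2)] at h1
  change (qpoly m).eval _ = _ at h1
  rw [h] at h1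
  simp [eq_comm, hm] at h1

section Root

variable {q : ℂ} {ℓ : ℕ}

theorem ne_zero_of_orderOf (hℓ : 3 ≤ ℓ) (hq : orderOf (q ^ 2) = ℓ) : q ≠ 0 := by
  rintro rfl
  have := pow_orderOf_eq_one ((0 : ℂ) ^ 2)
  rw [hq] at this
  simp [show ℓ ≠ 0 by omega] at this

theorem qnum_mul_sub_inv (hq0 : q ≠ 0) (m : ℕ) :
    qnum (-(q + q⁻¹)) m * (q - q⁻¹) = q ^ m - q⁻¹ ^ m := by
  have hqq : q * q⁻¹ = 1 := mul_inv_cancel₀ hq0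
  induction m using Nat.strong_induction_on with
  | _ m ih =>
    match m with
    | 0 => simp
    | 1 => simp
    | m + 2 =>
      have h1 := ih (m + 1) (by omega)
      have h2 := ih m (by omega)
      rw [qnum_add_two]
      linear_combination (q + q⁻¹) * h1 - h2 + (q ^ m - q⁻¹ ^ m) * hqq

theorem sub_inv_ne_zero (hℓ : 3 ≤ ℓ) (hq : orderOf (q ^ 2) = ℓ) : q - q⁻¹ ≠ 0 := by
  intro h
  have hq0 := ne_zero_of_orderOf hℓ hq
  have : q ^ 2 = 1 := by
    rw [sub_eq_zero] at h
    rw [sq]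
    nth_rw 2 [h]
    exact mul_inv_cancel₀ hq0
  rw [this, orderOf_one] at hq
  omega

theorem qnum_eq_zero_iff (hℓ : 3 ≤ ℓ) (hq : orderOf (q ^ 2) = ℓ) (m : ℕ) :
    qnum (-(q + q⁻¹)) m = 0 ↔ ℓ ∣ m := by
  have hq0 := ne_zero_of_orderOf hℓ hq
  have h := qnum_mul_sub_inv hq0 m
  rw [← mul_eq_zero_iff_right (sub_inv_ne_zero hℓ hq), h, ← hq, orderOf_dvd_iff_pow_eq_one,
    sub_eq_zero, inv_pow, ← mul_eq_one_iff_eq_inv₀ (pow_ne_zero m hq0), ← mul_pow, ← sq]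

/-- The multiplicity of the parameter as a root of a quantum integer. -/
noncomputable def qnumMult (q : ℂ) (m : ℕ) : ℕ := (qpoly m).roots.count (-(q + q⁻¹))

theorem qnumMult_eq_zero (hℓ : 3 ≤ ℓ) (hq : orderOf (q ^ 2) = ℓ) {m : ℕ} (hm : ¬ ℓ ∣ m) :
    qnumMult q m = 0 := by
  rw [qnumMult, Polynomial.count_roots]
  apply Polynomial.rootMultiplicity_eq_zero
  rw [Polynomial.IsRoot.def]
  rw [eval_qnum, qnum_eq_zero_iff hℓ hq]
  exact hm

/-- $[s\ell]=[\ell]\cdot[s]_{q^\ell}$, and since $q^\ell=\pm1$ the second factor takes the value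
$\pm s\ne0$, so it does not add to the order of vanishing. -/
theorem qnumMult_mul (hℓ : 3 ≤ ℓ) (hq : orderOf (q ^ 2) = ℓ) {s : ℕ} (hs : s ≠ 0) :
    qnumMult q (s * ℓ) = qnumMult q ℓ := by
  have hq0 := ne_zero_of_orderOf hℓ hq
  obtain ⟨k, hk⟩ : ∃ k, ℓ = k + 1 := ⟨ℓ - 1, by omega⟩
  have hne := qpoly_ne_zero (m := s * ℓ) (by positivity)
  have h1 : qpoly (s * ℓ) = qpoly ℓ * qnum (-(qpoly (k + 2) - qpoly k)) s := by
    rw [hk]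
    exact qnum_mul_succ _ k s
  have h2 : qnum (-(q + q⁻¹)) (k + 2) - qnum (-(q + q⁻¹)) k = 2 * q ^ ℓ := by
    apply mul_right_cancel₀ (sub_inv_ne_zero hℓ hq)
    have h3 : q ^ ℓ = q⁻¹ ^ ℓ := by
      have h := qnum_mul_sub_inv hq0 ℓ
      rw [(qnum_eq_zero_iff hℓ hq ℓ).2 dvd_rfl, zero_mul] at h
      exact (sub_eq_zero.1 h.symm)
    have h4 := qnum_mul_sub_inv hq0 (k + 2)
    have h5 := qnum_mul_sub_inv hq0 k
    have hqq : q * q⁻¹ = 1 := mul_inv_cancel₀ hq0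
    rw [hk] at h3 ⊢
    linear_combination h4 - h5 - (q - q⁻¹) * h3 + (q ^ k - q⁻¹ ^ k) * hqq
  have h6 : (q ^ ℓ) ^ 2 = 1 := by
    rw [← pow_mul, mul_comm, pow_mul, ← hq, pow_orderOf_eq_one]
  have h7 : (qnum (-(qpoly (k + 2) - qpoly k)) s).eval (-(q + q⁻¹)) ≠ 0 := by
    rw [← Polynomial.coe_evalRingHom, map_qnum, Polynomial.coe_evalRingHom, Polynomial.eval_neg,
      Polynomial.eval_sub, eval_qnum, eval_qnum, h2, qnum_neg_two_mul h6]
    exact mul_ne_zero (Nat.cast_ne_zero.2 hs) (pow_ne_zero _ (pow_ne_zero _ hq0))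
  rw [qnumMult, h1, Polynomial.roots_mul (h1 ▸ hne), Multiset.count_add, Polynomial.count_roots
    (qnum (-(qpoly (k + 2) - qpoly k)) s), Polynomial.rootMultiplicity_eq_zero h7, add_zero,
    qnumMult]

theorem qnumMult_add (hℓ : 3 ≤ ℓ) (hq : orderOf (q ^ 2) = ℓ) (a : ℕ) {j : ℕ} (hj : j ≠ 0) :
    qnumMult q (a * ℓ + j) = qnumMult q j := by
  by_cases h : ℓ ∣ j
  · obtain ⟨s, rfl⟩ := h
    rw [show a * ℓ + ℓ * s = (a + s) * ℓ by ring, mul_comm ℓ s]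
    have hs : s ≠ 0 := by
      rintro rfl
      simp at hj
    rw [qnumMult_mul hℓ hq hs, qnumMult_mul hℓ hq (by omega)]
  · rw [qnumMult_eq_zero hℓ hq h, qnumMult_eq_zero hℓ hq]
    rwa [Nat.dvd_add_right (Dvd.intro_left a rfl)]

end Root

/-! ### Order of vanishing of the Gram determinant -/

theorem Path.isEmpty_of_lt {t n : ℕ} (h : n < t) : IsEmpty (Path t n) :=
  ⟨fun p => absurd p.le (by omega)⟩

theorem Path.card_of_lt {t n : ℕ} (h : n < t) : Fintype.card (Path t n) = 0 :=
  Fintype.card_eq_zero_iff.2 (Path.isEmpty_of_lt h)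

theorem Path.card_succ (t n : ℕ) : Fintype.card (Path (t + 1) (n + 1)) =
    Fintype.card (Path t n) + Fintype.card (Path (t + 2) n) := by
  rw [← Fintype.card_congr (Path.equivSum t n), Fintype.card_sum]

theorem Path.card_zero_succ (n : ℕ) :
    Fintype.card (Path 0 (n + 1)) = Fintype.card (Path 1 n) :=
  (Fintype.card_congr (Path.equivDown n)).symm

instance : Unique (Path 0 0) := ⟨⟨.nil⟩, fun p => by cases p; rfl⟩

theorem det_gram_zero_zero : (gram 0 0).det = 1 := by
  rw [Matrix.det_unique]
  change formPoly .nil .nil = 1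
  refine polynomial_eq_of_eval_card 0 fun N hN => ?_
  rw [eval_formPoly_card _ _ _ (Fin.castLE_injective hN), Path.contract, Tuple.sum_zero]
  simp

theorem det_gram_of_lt {t n : ℕ} (h : n < t) : (gram t n).det = 1 := by
  have := Path.isEmpty_of_lt h
  exact Matrix.det_isEmpty

theorem det_gram_ne_zero (t n : ℕ) : (gram t n).det ≠ 0 := by
  induction n generalizing t with
  | zero =>
    match t with
    | 0 => rw [det_gram_zero_zero]; exact one_ne_zero
    | t + 1 => simp [det_gram_of_lt]
  | succ n ih =>
    match t with
    | 0 =>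
      rw [det_gram_zero_succ]
      exact mul_ne_zero (pow_ne_zero _ Polynomial.X_ne_zero) (ih 1)
    | t + 1 =>
      refine left_ne_zero_of_mul (b := qpoly (t + 2) ^ Fintype.card (Path (t + 2) n)) ?_
      rw [det_gram_succ]
      exact mul_ne_zero (ih t) (mul_ne_zero (pow_ne_zero _ (neg_ne_zero.2
        (qpoly_ne_zero (by omega)))) (ih (t + 2)))

/-- The multiplicity of the parameter as a root of the Gram determinant. -/
noncomputable def gramMult (q : ℂ) (t n : ℕ) : ℕ := (gram t n).det.roots.count (-(q + q⁻¹))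

theorem gramMult_succ (q : ℂ) (t n : ℕ) :
    gramMult q (t + 1) (n + 1) + Fintype.card (Path (t + 2) n) * qnumMult q (t + 2) =
      gramMult q t n + (Fintype.card (Path (t + 2) n) * qnumMult q (t + 3) +
        gramMult q (t + 2) n) := by
  have h1 : (-qpoly (t + 3)) ^ Fintype.card (Path (t + 2) n) ≠ 0 :=
    pow_ne_zero _ (neg_ne_zero.2 (qpoly_ne_zero (by omega)))
  have h2 : qpoly (t + 2) ^ Fintype.card (Path (t + 2) n) ≠ 0 :=
    pow_ne_zero _ (qpoly_ne_zero (by omega))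
  have h3 := mul_ne_zero h1 (det_gram_ne_zero (t + 2) n)
  have h := congrArg (fun p : ℂ[X] => p.roots.count (-(q + q⁻¹))) (det_gram_succ t n)
  simp only [Polynomial.roots_mul (mul_ne_zero (det_gram_ne_zero (t + 1) (n + 1)) h2),
    Polynomial.roots_mul (mul_ne_zero (det_gram_ne_zero t n) h3), Polynomial.roots_mul h3,
    Polynomial.roots_pow, Polynomial.roots_neg, Multiset.count_add, Multiset.count_nsmul] at h
  exact h

theorem gramMult_zero_succ (q : ℂ) (n : ℕ) :
    gramMult q 0 (n + 1) = Fintype.card (Path 1 n) * qnumMult q 2 + gramMult q 1 n := by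
  have h2 : qpoly 2 = -Polynomial.X := by simp [qpoly, qnum_add_two]
  have h3 := mul_ne_zero (pow_ne_zero (Fintype.card (Path 1 n)) Polynomial.X_ne_zero)
    (det_gram_ne_zero 1 n)
  rw [gramMult, det_gram_zero_succ, Polynomial.roots_mul h3, Polynomial.roots_pow,
    Multiset.count_add, Multiset.count_nsmul, qnumMult, h2, Polynomial.roots_neg, gramMult]

theorem qnumMult_one (q : ℂ) : qnumMult q 1 = 0 := by
  simp [qnumMult]

/-- The order of vanishing of the Gram determinant. -/
theorem gramMult_eq_sum (q : ℂ) (t n M : ℕ) (hM : n ≤ M) :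
    (gramMult q t n : ℤ) = ∑ j ∈ Finset.range M, (Fintype.card (Path (t + 2 * j + 2) n) : ℤ) *
      (qnumMult q (t + j + 2) - qnumMult q (j + 1)) := by
  induction n generalizing t with
  | zero =>
    have h1 : (gramMult q t 0 : ℤ) = 0 := by
      match t with
      | 0 => rw [gramMult, det_gram_zero_zero]; simp
      | t + 1 => simp [gramMult, det_gram_of_lt]
    rw [h1, Finset.sum_eq_zero]
    intro j _
    rw [Path.card_of_lt (by omega)]
    simp
  | succ n ih =>
    match t with
    | 0 =>
      -- The inhomogeneous term of the recursion is `h 0`. Written as a telescoping sum (`h M = 0`,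
      -- as no path climbs that high), it can be compared termwise with the sums from the induction
      -- hypothesis.
      let h : ℕ → ℤ := fun j => (Fintype.card (Path (2 * j + 1) n) : ℤ) *
        (qnumMult q (j + 2) - qnumMult q (j + 1))
      have hsum := Finset.sum_range_sub' h M
      have hM0 : h M = 0 := by
        simp [h, Path.card_of_lt (show n < 2 * M + 1 by omega)]
      have h0 : h 0 = (Fintype.card (Path 1 n) : ℤ) * qnumMult q 2 := by
        simp [h, qnumMult_one]
      rw [gramMult_zero_succ]
      push_cast
      rw [ih 1 (by omega), ← h0, ← sub_zero (h 0), ← hM0, ← hsum, ← Finset.sum_add_distrib]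
      refine Finset.sum_congr rfl fun j _ => ?_
      have e := Path.card_succ (2 * j + 1) n
      have e1 : 0 + 2 * j + 2 = 2 * j + 1 + 1 := by omega
      have e2 : 1 + 2 * j + 2 = 2 * j + 1 + 2 := by omega
      have e3 : 1 + j + 2 = j + 1 + 2 := by omega
      rw [e1, e, e2, e3]
      simp only [h, mul_add, mul_one, zero_add]
      push_cast
      ring_nf
    | t + 1 =>
      let h : ℕ → ℤ := fun j => (Fintype.card (Path (t + 2 * j + 2) n) : ℤ) *
        (qnumMult q (t + j + 3) - qnumMult q (t + j + 2))
      have hsum := Finset.sum_range_sub' h M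
      have hM0 : h M = 0 := by
        simp [h, Path.card_of_lt (show n < t + 2 * M + 2 by omega)]
      have h0 : h 0 = (Fintype.card (Path (t + 2) n) : ℤ) *
          (qnumMult q (t + 3) - qnumMult q (t + 2)) := by
        simp [h]
      have hrec := gramMult_succ q t n
      zify at hrec
      rw [ih t (by omega), ih (t + 2) (by omega)] at hrec
      have : (gramMult q (t + 1) (n + 1) : ℤ) = (h 0 - h M) +
          ((∑ j ∈ Finset.range M, (Fintype.card (Path (t + 2 * j + 2) n) : ℤ) *
            (qnumMult q (t + j + 2) - qnumMult q (j + 1))) +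
          ∑ j ∈ Finset.range M, (Fintype.card (Path (t + 2 + 2 * j + 2) n) : ℤ) *
            (qnumMult q (t + 2 + j + 2) - qnumMult q (j + 1))) := by
        rw [hM0, h0]
        linear_combination hrec
      rw [this, ← hsum, ← Finset.sum_add_distrib, ← Finset.sum_add_distrib]
      refine Finset.sum_congr rfl fun j _ => ?_
      have e := Path.card_succ (t + 2 * j + 2) n
      have e1 : t + 1 + 2 * j + 2 = t + 2 * j + 2 + 1 := by omega
      have e2 : t + 2 + 2 * j + 2 = t + 2 * j + 2 + 2 := by omega
      have e3 : t + 2 + j + 2 = t + (j + 1) + 3 := by omega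
      have e4 : t + 1 + j + 2 = t + j + 3 := by omega
      have e5 : t + 2 * (j + 1) + 2 = t + 2 * j + 2 + 2 := by omega
      have e6 : t + (j + 1) + 2 = t + j + 3 := by omega
      simp only [h]
      rw [e1, e, e2, e3, e4, e5, e6]
      push_cast
      ring

/-- The form is non-degenerate if `t + 1` is divisible by `ℓ`. -/
theorem rank_gramAt_of_dvd {q : ℂ} {ℓ : ℕ} (hℓ : 3 ≤ ℓ) (hq : orderOf (q ^ 2) = ℓ) {t : ℕ}
    (ht : ℓ ∣ t + 1) (n : ℕ) :
    (gramAt (-(q + q⁻¹)) t n).rank = Fintype.card (Path t n) := by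
  obtain ⟨a, ha⟩ := ht
  have h0 : gramMult q t n = 0 := by
    zify
    rw [gramMult_eq_sum q t n n le_rfl, Finset.sum_eq_zero]
    intro j _
    -- Periodicity makes every difference in the sum vanish.
    rw [show t + j + 2 = a * ℓ + (j + 1) by rw [mul_comm, ← ha]; ring,
      qnumMult_add hℓ hq a (by omega), sub_self, mul_zero]
  apply Matrix.rank_of_det_ne_zero
  have := RingHom.map_det (Polynomial.evalRingHom (-(q + q⁻¹))) (gram t n)
  rw [RingHom.mapMatrix_apply] at this
  rw [gramAt, ← this]
  intro hroot
  rw [gramMult, Polynomial.count_roots, Polynomial.rootMultiplicity_eq_zero_iff] at h0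
  exact det_gram_ne_zero t n (h0 hroot)

/-! ### Generating functions between the walls -/

theorem catalanC_eq : catalanC = 1 + PowerSeries.X * catalanC ^ 2 := by
  have h := congrArg (PowerSeries.map (Nat.castRingHom ℚ))
    PowerSeries.catalanSeries_sq_mul_X_add_one
  rw [map_add, map_mul, map_pow, map_one, PowerSeries.map_X] at h
  change catalanC ^ 2 * _ + 1 = catalanC at h
  linear_combination -h

/-- The number of monic diagrams is a coefficient of a power of the Catalan series. -/
theorem Path.card_eq_coeff (t n k : ℕ) (h : n = t + 2 * k) :
    (Fintype.card (Path t n) : ℚ) = PowerSeries.coeff k (catalanC ^ (t + 1)) := by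
  induction n generalizing t k with
  | zero =>
    obtain rfl : t = 0 := by omega
    obtain rfl : k = 0 := by omega
    rw [Fintype.card_unique]
    simp [catalanC]
  | succ n ih =>
    match t, k with
    | 0, 0 => omega
    | 0, k + 1 =>
      rw [Path.card_zero_succ, ih 1 k (by omega), zero_add, pow_one]
      conv_rhs => rw [catalanC_eq]
      simp [PowerSeries.coeff_succ_X_mul, PowerSeries.coeff_one]
    | t + 1, k =>
      have e : catalanC ^ (t + 1 + 1) = catalanC ^ (t + 1) + PowerSeries.X * catalanC ^ (t + 3) := by
        linear_combination catalanC ^ (t + 1) * catalanC_eq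
      rw [Path.card_succ, Nat.cast_add, ih t k (by omega), e, map_add]
      congr 1
      match k with
      | 0 => simp [Path.card_of_lt (show n < t + 2 by omega)]
      | k + 1 => rw [ih (t + 2) k (by omega), PowerSeries.coeff_succ_X_mul]

theorem chebSeries_add_three (i : ℕ) :
    chebSeries (i + 3) = chebSeries (i + 2) - PowerSeries.X * chebSeries (i + 1) := by
  simp [chebSeries, chebPoly]

/-- The series of the dimensions of the simple modules in the column of a multiple of `ℓ`. -/
noncomputable def columnSeries (ℓ a i : ℕ) : ℚ⟦X⟧ :=
  chebSeries i * (chebSeries ℓ)⁻¹ * catalanC ^ (a * ℓ)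

theorem columnSeries_add_three (ℓ a i : ℕ) :
    columnSeries ℓ a (i + 2) =
      columnSeries ℓ a (i + 3) + PowerSeries.X * columnSeries ℓ a (i + 1) := by
  simp only [columnSeries, chebSeries_add_three]
  ring

theorem columnSeries_one (ℓ a : ℕ) : columnSeries ℓ a 1 = columnSeries ℓ a 2 := by
  simp [columnSeries, chebSeries, chebPoly]

theorem columnSeries_self {ℓ : ℕ} (hℓ : ℓ ≠ 0) (a : ℕ) :
    columnSeries ℓ a ℓ = catalanC ^ (a * ℓ) := by
  obtain ⟨k, rfl⟩ := Nat.exists_eq_succ_of_ne_zero hℓ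
  have : PowerSeries.constantCoeff (chebSeries k.succ) ≠ 0 := by
    rw [constantCoeff_chebSeries]
    exact one_ne_zero
  rw [columnSeries, PowerSeries.mul_inv_cancel _ this, one_mul]

/-- Induction on `n` by the rank recursion. Here `i` is the distance from `t + 1` to the next
multiple of `ℓ`, so lowering `t` raises the index of $p_i$. -/
theorem rank_gramAt_eq_coeff {q : ℂ} {ℓ : ℕ} (hℓ : 3 ≤ ℓ) (hq : orderOf (q ^ 2) = ℓ)
    (n t k a i : ℕ) (hn : n = t + 2 * k) (hi : t + 1 + i = (a + 1) * ℓ) (hi0 : i ≠ 0)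
    (hil : i < ℓ) :
    ((gramAt (-(q + q⁻¹)) t n).rank : ℚ) = PowerSeries.coeff k (columnSeries ℓ a i) := by
  have hdvd : ∀ m, ¬ ℓ ∣ m → qnum (-(q + q⁻¹)) m ≠ 0 := fun m hm h =>
    hm ((qnum_eq_zero_iff hℓ hq m).1 h)
  have hzero : t = 0 → a = 0 := by
    rintro rfl
    by_contra ha
    have : 1 * ℓ ≤ a * ℓ := Nat.mul_le_mul_right ℓ (Nat.one_le_iff_ne_zero.2 ha)
    rw [add_mul] at hi
    omega
  induction n generalizing t k i with
  | zero =>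
    obtain rfl : t = 0 := by omega
    obtain rfl : k = 0 := by omega
    obtain rfl := hzero rfl
    have h1 : IsUnit (gramAt (-(q + q⁻¹)) 0 0) := by
      rw [Matrix.isUnit_iff_isUnit_det]
      have := RingHom.map_det (Polynomial.evalRingHom (-(q + q⁻¹))) (gram 0 0)
      rw [RingHom.mapMatrix_apply] at this
      rw [gramAt, ← this, det_gram_zero_zero, map_one]
      exact isUnit_one
    obtain ⟨i, rfl⟩ := Nat.exists_eq_succ_of_ne_zero hi0
    obtain ⟨l, rfl⟩ : ∃ l, ℓ = l + 1 := ⟨ℓ - 1, by omega⟩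
    rw [Matrix.rank_of_isUnit _ h1, Fintype.card_unique]
    simp [columnSeries, constantCoeff_chebSeries]
  | succ n ih =>
    match t with
    | 0 =>
      obtain rfl := hzero rfl
      obtain ⟨k, rfl⟩ : ∃ k', k = k' + 1 := ⟨k - 1, by omega⟩
      obtain ⟨i, rfl⟩ : ∃ i', i = i' + 2 := ⟨i - 2, by omega⟩
      have h2 := hdvd 2 (fun h => by have := Nat.le_of_dvd two_pos h; omega)
      have h3 : (-(q + q⁻¹)) ≠ 0 := by
        intro h
        apply h2
        rw [qnum_add_two, h]
        simp
      obtain rfl : ℓ = i + 3 := by omega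
      -- For `t = 0` the lower neighbour would be the wall `a = 0`, whose series is $c^0=1$; it does
      -- not contribute to the positive coefficient `k + 1`.
      rw [rank_gramAt_zero_succ _ _ h3, columnSeries_add_three, columnSeries_self (by omega),
        ih 1 k (i + 1) (by omega) (by omega) (by omega) (by omega) (by omega)]
      simp [PowerSeries.coeff_succ_X_mul, PowerSeries.coeff_one]
    | t + 1 =>
      have hfirst : ((gramAt (-(q + q⁻¹)) t n).rank : ℚ) =
          PowerSeries.coeff k (columnSeries ℓ a (i + 1)) := by
        -- If `t` lies on the lower wall, the form is non-degenerate and the dimension is the number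
        -- of paths, a coefficient of $c^{t+1}=c^{a\ell}$.
        by_cases h : i + 1 = ℓ
        · have ht : t + 1 = a * ℓ := by
            rw [add_mul] at hi
            omega
          rw [rank_gramAt_of_dvd hℓ hq (Dvd.intro_left a ht.symm),
            Path.card_eq_coeff t n k (by omega), h, columnSeries_self (by omega), ht]
        · exact ih t k (i + 1) (by omega) (by omega) (by omega) (by omega) (by
            rintro rfl
            by_contra ha
            have : 1 * ℓ ≤ a * ℓ := Nat.mul_le_mul_right ℓ (Nat.one_le_iff_ne_zero.2 ha)
            rw [add_mul] at hi
            omega)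
      have hne : ¬ ℓ ∣ t + 2 := by
        intro h
        have h' := (Nat.dvd_add_right h).1 (hi ▸ Dvd.intro_left (a + 1) rfl : ℓ ∣ t + 2 + i)
        have := Nat.le_of_dvd (by omega) h'
        omega
      rw [rank_gramAt_succ _ _ _ (hdvd _ hne), Nat.cast_add, hfirst]
      match i with
      -- Just below the upper wall $[t+3]=0$ removes the second summand, which matches $p_1=p_2$.
      | 1 =>
        rw [if_pos ((qnum_eq_zero_iff hℓ hq _).2 (Dvd.intro_left (a + 1) hi.symm)),
          columnSeries_one]
        simp
      | i + 2 =>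
        have hne' : ¬ ℓ ∣ t + 3 := by
          intro h
          have h' := (Nat.dvd_add_right h).1
            ((by rw [show t + 3 + (i + 1) = (a + 1) * ℓ by omega]; exact Dvd.intro_left _ rfl) :
              ℓ ∣ t + 3 + (i + 1))
          have := Nat.le_of_dvd (by omega) h'
          omega
        rw [if_neg (hdvd _ hne'), columnSeries_add_three ℓ a i, map_add]
        congr 1
        match k with
        | 0 =>
          have := Path.isEmpty_of_lt (show n < t + 2 by omega)
          have h0 := Matrix.rank_le_card_width (gramAt (-(q + q⁻¹)) (t + 2) n)
          rw [Fintype.card_eq_zero] at h0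
          rw [Nat.le_zero.1 h0]
          simp
        | k + 1 =>
          rw [ih (t + 2) k (i + 1) (by omega) (by omega) (by omega) (by omega) (by omega),
            PowerSeries.coeff_succ_X_mul]

end TemperleyLieb

theorem mainTheorem2 (q : ℂ) (ℓ : ℕ) (hℓ : 3 ≤ ℓ) (hq : orderOf (q ^ 2) = ℓ)
    (t a b : ℕ) (hb : b ≤ ℓ - 2) (ht : t = a * ℓ + b) :
    TemperleyLieb.simpleSeries q t =
      TemperleyLieb.chebSeries (ℓ - 1 - b) * (TemperleyLieb.chebSeries ℓ)⁻¹ *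
        TemperleyLieb.catalanC ^ (a * ℓ) := by
  ext k
  rw [TemperleyLieb.simpleSeries, PowerSeries.coeff_mk, TemperleyLieb.finrank_cellHead]
  exact TemperleyLieb.rank_gramAt_eq_coeff hℓ hq (t + 2 * k) t k a (ℓ - 1 - b) rfl
    (by rw [ht, add_mul]; omega) (by omega) (by omega)
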